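/- For a polynomial $f$ over $\mathbb{F}_2$ in $n$ variables let $\mathrm{gap}(f)=\sum_{x\in\{0,1\}^n}(-1)^{f(x)}=|\{x:f(x)=0\}|-|\{x:f(x)=1\}|$. A function $F$ from bit strings to natural numbers is in \#P if there is a polynomial-time computable map sending each bit string $w$ to a Boolean circuit $C_w$ (with AND, OR and NOT gates, finitely many input bits and one output bit) such that $F(w)=|\{x:C_w(x)=1\}|$ for all $w$. A function $G$ is \#P-hard to compute if every $F$ in \#P reduces to $G$ in polynomial time, in the following sense: there are polynomial-time computable maps $R$ and $S$ such that $F(w)=S(w,G(R(w)))$ for all bit strings $w$. Then it is \#P-hard to compute $\mathrm{gap}(f)$ exactly, given a multilinear polynomial $f$ of degree $3$ over $\mathbb{F}_2$ (presented by its number of variables, in unary, and the list of its monomials). -/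

import Mathlib

/-! ### Classical Boolean circuits and circuit counting -/

/-- A gate of a Boolean circuit. The arguments are the numbers of the wires it reads. -/
inductive BoolGate where
  | and (i j : ℕ)
  | or (i j : ℕ)
  | not (i : ℕ)

namespace BoolGate

/-- The wires read by a gate. -/
def inputs : BoolGate → List ℕ
  | .and i j => [i, j]
  | .or i j => [i, j]
  | .not i => [i]

/-- The output bit of a gate, given the list of the values of the wires already computed. -/
def eval (w : List Bool) : BoolGate → Bool
  | .and i j => w.getD i false && w.getD j false
  | .or i j => w.getD i false || w.getD j false
  | .not i => !(w.getD i false)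

end BoolGate

/-- A Boolean circuit with AND, OR and NOT gates, several input bits and one output bit.
Wires `0, …, numInputs - 1` are the inputs, wire `numInputs + k` is the output of gate `k`
(gates are numbered from `0`); a gate reads only inputs and outputs of earlier gates. -/
structure BoolCircuit where
  numInputs : ℕ
  gates : List BoolGate
  out : ℕ
  gates_wf : ∀ (k : ℕ) (hk : k < gates.length), ∀ i ∈ (gates[k]).inputs, i < numInputs + k
  out_wf : out < numInputs + gates.length

namespace BoolCircuit

/-- The values of all wires: start with the input bits and append the outputs of the gates. -/
def wireValues (C : BoolCircuit) (x : Fin C.numInputs → Bool) : List Bool :=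
  C.gates.foldl (fun w g => w ++ [g.eval w]) (List.ofFn x)

/-- The output bit `C(x)`. -/
def eval (C : BoolCircuit) (x : Fin C.numInputs → Bool) : Bool :=
  (C.wireValues x).getD C.out false

/-- Circuit counting: the number of inputs `x` with `C(x) = 1`. -/
def count (C : BoolCircuit) : ℕ :=
  (Finset.univ.filter (fun x : Fin C.numInputs → Bool => C.eval x = true)).card

end BoolCircuit

/-- The alphabet used to write circuits. -/
inductive CircuitSymbol where
  | tick
  | comma
  | and
  | or
  | not
  deriving DecidableEq

instance : Fintype CircuitSymbol :=
  ⟨{.tick, .comma, .and, .or, .not}, fun x => by cases x <;> simp⟩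

/-- A gate is written as its type followed by the wires it reads (in unary). -/
def BoolGate.encode : BoolGate → List CircuitSymbol
  | .and i j => .and :: (List.replicate i .tick ++ .comma :: List.replicate j .tick)
  | .or i j => .or :: (List.replicate i .tick ++ .comma :: List.replicate j .tick)
  | .not i => .not :: List.replicate i .tick

/-- A circuit is written as the number of inputs and the output wire (both in unary),
followed by its gates. -/
def BoolCircuit.encode (C : BoolCircuit) : List CircuitSymbol :=
  List.replicate C.numInputs .tick ++ .comma :: (List.replicate C.out .tick ++
    C.gates.flatMap BoolGate.encode)

/-! ### Multilinear polynomials over the field with two elements -/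

/-- The gap of a polynomial over `𝔽₂`: the sum of `(-1)^{f(x)}` over all points `x`. -/
noncomputable def gap {n : ℕ} (f : MvPolynomial (Fin n) (ZMod 2)) : ℤ :=
  ∑ x : Fin n → ZMod 2, (-1 : ℤ) ^ (MvPolynomial.eval x f).val

/-- A multilinear polynomial over `𝔽₂` in `numVars` variables, given as the list of its
monomials. There are no repeated monomials, and each monomial is given by the strictly
increasing list of its variables (the empty list is the constant monomial `1`). -/
structure F2Poly where
  numVars : ℕ
  monomials : List (List (Fin numVars))
  increasing : ∀ m ∈ monomials, m.Pairwise (· < ·)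
  nodup : monomials.Nodup

namespace F2Poly

/-- The polynomial denoted by the list of monomials. -/
noncomputable def toMvPolynomial (p : F2Poly) : MvPolynomial (Fin p.numVars) (ZMod 2) :=
  (p.monomials.map (fun m => (m.map MvPolynomial.X).prod)).sum

end F2Poly

/-- The alphabet used to write polynomials. -/
inductive PolySymbol where
  | tick
  | comma
  | plus
  deriving DecidableEq

instance : Fintype PolySymbol :=
  ⟨{.tick, .comma, .plus}, fun x => by cases x <;> simp⟩

/-- A polynomial is written as the number of variables (in unary), followed by its monomials,
each one being a `plus` followed by its variables, each one being a `comma` followed by the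
number of the variable in unary. -/
def F2Poly.encode (p : F2Poly) : List PolySymbol :=
  List.replicate p.numVars .tick ++
    p.monomials.flatMap (fun m => .plus ::
      m.flatMap (fun i => .comma :: List.replicate (i : ℕ) .tick))

/-- The polynomials over `𝔽₂` of degree `3`. -/
def CubicF2Poly : Type := {p : F2Poly // p.toMvPolynomial.totalDegree = 3}

/-- The encoding of a polynomial of degree `3`. -/
def CubicF2Poly.encode (p : CubicF2Poly) : List PolySymbol := p.1.encode

/-- The problem of computing the gap of a polynomial of degree `3`. -/
noncomputable def CubicF2Poly.gap (p : CubicF2Poly) : ℤ := _root_.gap p.1.toMvPolynomial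

/-! ### Polynomial time, the class #P, and #P-hardness -/

/-- Integers are written as a sign bit followed by the absolute value in binary. -/
def encodeInt (z : ℤ) : List Bool := decide (z < 0) :: Computability.encodeNat z.natAbs

/-- Pairs are written as the two components one after the other, over disjoint alphabets. -/
def encodePair {α β Γ Δ : Type} (ea : α → List Γ) (eb : β → List Δ) (p : α × β) :
    List (Γ ⊕ Δ) :=
  (ea p.1).map Sum.inl ++ (eb p.2).map Sum.inr

/-- `f` is computed by a (multi-tape) Turing machine in time polynomial in the length of the
encoding of its input. -/
def PolyTimeComputable {α β Γ Δ : Type} (ea : α → List Γ) (eb : β → List Δ) (f : α → β) :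
    Prop :=
  Nonempty (Turing.TM2ComputableInPolyTime ea eb f)

/-- The class #P: the functions from bit strings to natural numbers that can be expressed as
circuit counting, for a circuit that is computed from the bit string in polynomial time. -/
def InSharpP (F : List Bool → ℕ) : Prop :=
  ∃ C : List Bool → BoolCircuit,
    PolyTimeComputable id BoolCircuit.encode C ∧ ∀ x, F x = (C x).count

/-- Polynomial-time reduction of the function `F` to the function `G`: the value of `F` at `x`
is obtained in polynomial time from `x` and from the value of `G` at one instance `R x`, which is
computed from `x` in polynomial time. -/
def PolyTimeReducible {α β Γ Δ : Type} (F : List Bool → ℕ)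
    (ea : α → List Γ) (eb : β → List Δ) (G : α → β) : Prop :=
  ∃ (R : List Bool → α) (S : List Bool × β → ℕ),
    PolyTimeComputable id ea R ∧
    PolyTimeComputable (encodePair id eb) Computability.encodeNat S ∧
    ∀ x, F x = S (x, G (R x))

/-- #P-hardness of computing the function `G` (with inputs and outputs encoded by `ea`, `eb`):
every function in #P reduces to it in polynomial time. -/
def SharpPHard {α β Γ Δ : Type} (ea : α → List Γ) (eb : β → List Δ) (G : α → β) : Prop :=
  ∀ F : List Bool → ℕ, InSharpP F → PolyTimeReducible F ea eb G

/-! A sum of signs can enforce equations over `𝔽₂`: summing `(-1)^(c * e)` over a fresh multiplier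
`c` gives `2` if `e = 0` and `0` if `e = 1`. Each gate of a circuit gets a block of four variables:
a copy `a` of its first input `x`, its value `b`, and two multipliers `c`, `d`. The block
contributes the cubic terms `c * (x + a) + d * (b + p a)`, where `p a` is the output of the gate in
terms of `a` and the second input. Summing over the block (`sum_gate_block`) sets `a = x` and `b = p
x`, with a factor `4`. Because of the copy, the product of the two inputs always pairs an old
variable with one of the new block. The monomials are therefore strictly increasing and without
repetition, even if the gate reads the same wire twice or reads its wires in decreasing order.

A switch makes the count readable from the gap. Block `0` has variables `s, t, y, z` with terms `s *
y + (s + 1) * t * z`, an input block has `a * c + (s + 1) * b * d`, and the output wire `o` enters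
through `s * y * o`. Let `n` be the number of inputs and `g` the number of gates. For `s = 1` the
inputs `b` are free and the sum over `y` is `1 - (-1)^C(x)`, so this half contributes `4^(n+g) * 8 *
count`. For `s = 0` every input is forced to `0` and this half contributes `4^(n+g+1)`. Hence
(`gap_toCubic`) the gap is `4^(n+g+1) * (2 * count + 1)`. Since the last factor is odd, the count is
what remains of the binary expansion after its low zeros and its lowest one are removed
(`oddIndex_eq`); the exponent need not be known.

The remaining work is the time bound. Programs with counters are compiled to stack machines step by
step (`Exec.stepsIn`). One program writes the polynomial of a circuit in quadratic time
(`Exec.circuitProg`), another decodes the gap by deleting a prefix. Machines are composed by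
`TM2ComputableInPolyTime.comp`, where the intermediate word stays polynomially long because each
step makes a bounded number of pushes. -/

/-! ### Runs of stack machines -/

namespace Turing

open TM2

/-- `StepsIn f a b t`: iterating the partial function `f` from `a` reaches `b` after `t` steps. -/
inductive StepsIn {α : Type*} (f : α → Option α) : α → α → ℕ → Prop
  | refl (a : α) : StepsIn f a a 0
  | head {a b c : α} {t : ℕ} : f a = some b → StepsIn f b c t → StepsIn f a c (t + 1)

namespace StepsIn

variable {α : Type*} {f : α → Option α}

theorem single {a b : α} (h : f a = some b) : StepsIn f a b 1 := .head h (.refl b)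

theorem trans {a b c : α} {s t : ℕ} (h₁ : StepsIn f a b s) (h₂ : StepsIn f b c t) :
    StepsIn f a c (s + t) := by
  induction h₁ with
  | refl => simpa using h₂
  | head h _ ih => rw [Nat.add_right_comm]; exact .head h (ih h₂)

theorem iterate_eq {a b : α} {t : ℕ} (h : StepsIn f a b t) :
    (flip bind f)^[t] (some a) = some b := by
  induction h with
  | refl => rfl
  | head h _ ih => rw [Function.iterate_succ_apply]; simpa [flip, h] using ih

theorem iterate_none (t : ℕ) : (flip bind f)^[t] (none : Option α) = none := by
  induction t with
  | zero => rfl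
  | succ t ih => rw [Function.iterate_succ_apply]; simpa [flip] using ih

/-- The value `none` is absorbing under iteration, so reaching `some b` after `t` rounds means that
every intermediate step was defined. -/
theorem of_iterate_eq {t : ℕ} : ∀ {a b : α}, (flip bind f)^[t] (some a) = some b →
    StepsIn f a b t := by
  induction t with
  | zero => intro a b h; cases h; exact .refl a
  | succ t ih =>
    intro a b h
    rw [Function.iterate_succ_apply] at h
    cases hfa : f a with
    | none =>
      have e : flip bind f (some a) = none := hfa
      rw [e, iterate_none] at h
      cases h
    | some c => exact .head hfa (ih (by simpa [flip, hfa] using h))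

/-- A map that commutes with the steps transports runs. -/
theorem map {β : Type*} {g : β → Option β} (φ : α → β)
    (hφ : ∀ a b, f a = some b → g (φ a) = some (φ b)) {a b : α} {t : ℕ} (h : StepsIn f a b t) :
    StepsIn g (φ a) (φ b) t := by
  induction h with
  | refl => exact .refl _
  | head h _ ih => exact .head (hφ _ _ h) ih

end StepsIn

theorem initList_stk (tm : FinTM2) (s : List (tm.Γ tm.k₀)) :
    (initList tm s).stk = Function.update (fun _ => []) tm.k₀ s := by
  funext k
  by_cases h : k = tm.k₀
  · subst h; simp [initList]
  · simp [initList, h]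

theorem haltList_stk (tm : FinTM2) (s : List (tm.Γ tm.k₁)) :
    (haltList tm s).stk = Function.update (fun _ => []) tm.k₁ s := by
  funext k
  by_cases h : k = tm.k₁
  · subst h; simp [haltList]
  · simp [haltList, h]

/-! ### Stack growth is linear in the running time -/

section PushBound

variable {K : Type*} {Γ : K → Type*} {Λ σ : Type*} [DecidableEq K]

/-- A bound for the number of pushes done by a statement. -/
def TM2.Stmt.size : Stmt Γ Λ σ → ℕ
  | .push _ _ q => q.size + 1
  | .peek _ _ q => q.size
  | .pop _ _ q => q.size
  | .load _ q => q.size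
  | .branch _ q₁ q₂ => q₁.size + q₂.size
  | .goto _ => 0
  | .halt => 0

theorem TM2.length_stepAux_le (q : Stmt Γ Λ σ) (v : σ) (S : ∀ k, List (Γ k)) (k : K) :
    ((stepAux q v S).stk k).length ≤ (S k).length + q.size := by
  induction q generalizing v S with
  | push k' f q ih =>
    refine (ih _ _).trans ?_
    by_cases h : k = k'
    · subst h; simp [Stmt.size]; omega
    · simp [Stmt.size, h]
  | peek k' f q ih => exact ih _ _
  | pop k' f q ih =>
    refine (ih _ _).trans ?_
    by_cases h : k = k'
    · subst h; simp [Stmt.size]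
    · simp [Stmt.size, h]
  | load f q ih => exact ih _ _
  | branch f q₁ q₂ ih₁ ih₂ =>
    simp only [stepAux, Stmt.size]
    cases f v
    · exact (ih₂ _ _).trans (by omega)
    · exact (ih₁ _ _).trans (by omega)
  | goto f => simp [stepAux, Stmt.size]
  | halt => simp [stepAux, Stmt.size]

theorem TM2.length_stk_le [Fintype Λ] (M : Λ → Stmt Γ Λ σ) {c c' : Cfg Γ Λ σ} {t : ℕ}
    (h : StepsIn (TM2.step M) c c' t) (k : K) :
    (c'.stk k).length ≤ (c.stk k).length + t * ∑ l, (M l).size := by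
  induction h with
  | refl => simp
  | @head a b c t h _ ih =>
    refine ih.trans ?_
    obtain ⟨l, v, S⟩ := a
    cases l with
    | none => simp at h
    | some l =>
      simp only [TM2.step, Option.some.injEq] at h
      have h₁ := TM2.length_stepAux_le (M l) v S k
      rw [h] at h₁
      have h₂ : (M l).size ≤ ∑ l, (M l).size :=
        Finset.single_le_sum (f := fun l => (M l).size) (fun _ _ => Nat.zero_le _)
          (Finset.mem_univ l)
      have h₃ := h₁.trans (Nat.add_le_add_left h₂ _)
      linarith

end PushBound

/-! ### Translating statements along an embedding -/

section Embed

variable {K K' : Type*} {Γ' : K' → Type*} {Λ Λ' σ σ' : Type*}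

/-- Rewrite a statement for another machine: the stacks are renamed by `κ`, the internal state is
read by `get` and written by `set`, labels are renamed by `lab`, and instead of halting the
machine goes on at `fin`. -/
def TM2.Stmt.embed (κ : K → K') (get : σ' → σ) (set : σ' → σ → σ') (lab : Λ → Λ')
    (fin : Option Λ') : Stmt (fun k => Γ' (κ k)) Λ σ → Stmt Γ' Λ' σ'
  | .push k f q => .push (κ k) (fun v => f (get v)) (q.embed κ get set lab fin)
  | .peek k f q => .peek (κ k) (fun v o => set v (f (get v) o)) (q.embed κ get set lab fin)
  | .pop k f q => .pop (κ k) (fun v o => set v (f (get v) o)) (q.embed κ get set lab fin)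
  | .load f q => .load (fun v => set v (f (get v))) (q.embed κ get set lab fin)
  | .branch f q₁ q₂ => .branch (fun v => f (get v)) (q₁.embed κ get set lab fin)
      (q₂.embed κ get set lab fin)
  | .goto f => .goto (fun v => lab (f (get v)))
  | .halt => fin.elim .halt fun l => .goto fun _ => l

variable [DecidableEq K] [DecidableEq K']

/-- The configuration that corresponds to a given one under an embedding of machines. -/
def TM2.Cfg.embed {κ : K → K'} (put : σ → σ')
    (stk : (∀ k, List (Γ' (κ k))) → ∀ k, List (Γ' k)) (lab : Λ → Λ') (fin : Option Λ')
    (c : Cfg (fun k => Γ' (κ k)) Λ σ) : Cfg Γ' Λ' σ' :=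
  ⟨c.l.elim fin fun l => some (lab l), put c.var, stk c.stk⟩

/-- The hypotheses say that the small machine sees its own state and stacks inside the large ones
and that its updates touch nothing else. Halting costs no extra step: `Cfg.embed` sends a halted
configuration to one that is already at `fin`. -/
theorem TM2.stepAux_embed {κ : K → K'} {get : σ' → σ} {set : σ' → σ → σ'} {lab : Λ → Λ'}
    {fin : Option Λ'} {put : σ → σ'} {stk : (∀ k, List (Γ' (κ k))) → ∀ k, List (Γ' k)}
    (h_get : ∀ v, get (put v) = v) (h_set : ∀ v w, set (put v) w = put w)
    (h_stk : ∀ T k, stk T (κ k) = T k)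
    (h_upd : ∀ T k x, Function.update (stk T) (κ k) x = stk (Function.update T k x))
    (q : Stmt (fun k => Γ' (κ k)) Λ σ) (v : σ) (T : ∀ k, List (Γ' (κ k))) :
    stepAux (q.embed κ get set lab fin) (put v) (stk T) =
      (stepAux q v T).embed put stk lab fin := by
  induction q generalizing v T with
  | push k f q ih => simp only [Stmt.embed, stepAux, h_get, h_stk, h_upd, ih]
  | peek k f q ih => simp only [Stmt.embed, stepAux, h_get, h_set, h_stk, ih]
  | pop k f q ih => simp only [Stmt.embed, stepAux, h_get, h_set, h_stk, h_upd, ih]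
  | load f q ih => simp only [Stmt.embed, stepAux, h_get, h_set, ih]
  | branch f q₁ q₂ ih₁ ih₂ =>
    simp only [Stmt.embed, stepAux, h_get]
    cases f v
    · exact ih₂ _ _
    · exact ih₁ _ _
  | goto f => simp [Stmt.embed, stepAux, Cfg.embed, h_get]
  | halt => cases fin <;> simp [Stmt.embed, stepAux, Cfg.embed]

end Embed

/-! ### Composition -/

section Comp

variable (M₁ M₂ : FinTM2) {B : Type} (e₁ : M₁.Γ M₁.k₁ ≃ B) (e₂ : M₂.Γ M₂.k₀ ≃ B)

/-- The stack alphabets of the composition: those of both machines, and an auxiliary stack. -/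
abbrev CompΓ (B : Type) : M₁.K ⊕ M₂.K ⊕ Unit → Type
  | .inl k => M₁.Γ k
  | .inr (.inl k) => M₂.Γ k
  | .inr (.inr _) => Option B

/-- The internal states of the composition. -/
abbrev CompState (B : Type) : Type := M₁.σ × M₂.σ × Option B

/-- The labels of the composition: those of both machines, and two labels for the transfer of the
output of the first machine to the auxiliary stack, and from there to the second machine. -/
abbrev CompLabel : Type := M₁.Λ ⊕ M₂.Λ ⊕ Bool

/-- Join the stacks of both machines and the auxiliary stack. -/
def compStk {M₁ M₂ : FinTM2} (S₁ : ∀ k, List (M₁.Γ k)) (S₂ : ∀ k, List (M₂.Γ k))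
    (T : List (Option B)) : ∀ k, List (CompΓ M₁ M₂ B k)
  | .inl k => S₁ k
  | .inr (.inl k) => S₂ k
  | .inr (.inr _) => T

variable {M₁ M₂}

theorem update_compStk_inl (S₁ : ∀ k, List (M₁.Γ k)) (S₂ : ∀ k, List (M₂.Γ k))
    (T : List (Option B)) (k : M₁.K) (x : List (M₁.Γ k)) :
    Function.update (compStk S₁ S₂ T) (.inl k) x = compStk (Function.update S₁ k x) S₂ T := by
  funext k'
  rcases k' with k' | k' | k'
  · by_cases h : k' = k
    · subst h; simp [compStk]
    · simp [compStk, h]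
  · simp [compStk]
  · simp [compStk]

theorem update_compStk_inr (S₁ : ∀ k, List (M₁.Γ k)) (S₂ : ∀ k, List (M₂.Γ k))
    (T : List (Option B)) (k : M₂.K) (x : List (M₂.Γ k)) :
    Function.update (compStk S₁ S₂ T) (.inr (.inl k)) x =
      compStk S₁ (Function.update S₂ k x) T := by
  funext k'
  rcases k' with k' | k' | k'
  · simp [compStk]
  · by_cases h : k' = k
    · subst h; simp [compStk]
    · simp [compStk, h]
  · simp [compStk]

theorem update_compStk_aux (S₁ : ∀ k, List (M₁.Γ k)) (S₂ : ∀ k, List (M₂.Γ k))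
    (T x : List (Option B)) (u : Unit) :
    Function.update (compStk S₁ S₂ T) (.inr (.inr u)) x = compStk S₁ S₂ x := by
  funext k'
  rcases k' with k' | k' | k' <;> simp [compStk]

variable (M₁ M₂) [Inhabited B]

/-- The program of the composition. -/
def compProg : CompLabel M₁ M₂ → Stmt (CompΓ M₁ M₂ B) (CompLabel M₁ M₂) (CompState M₁ M₂ B)
  | .inl l => (M₁.m l).embed (Γ' := CompΓ M₁ M₂ B) Sum.inl (fun v => v.1) (fun v w => (w, v.2))
      Sum.inl (some (.inr (.inr false)))
  | .inr (.inl l) => (M₂.m l).embed (Γ' := CompΓ M₁ M₂ B) (fun k => Sum.inr (Sum.inl k))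
      (fun v => v.2.1) (fun v w => (v.1, w, v.2.2)) (fun l => Sum.inr (Sum.inl l)) none
  | .inr (.inr false) =>
    .pop (.inl M₁.k₁) (fun v o => (v.1, v.2.1, o.map e₁)) <|
    .branch (fun v => v.2.2.isSome)
      (.push (.inr (.inr ())) (fun v => v.2.2) <| .load (fun v => (v.1, v.2.1, none)) <|
        .goto fun _ => .inr (.inr false))
      (.goto fun _ => .inr (.inr true))
  | .inr (.inr true) =>
    .pop (.inr (.inr ())) (fun v o => (v.1, v.2.1, o.join)) <|
    .branch (fun v => v.2.2.isSome)
      (.push (.inr (.inl M₂.k₀)) (fun v => e₂.symm (v.2.2.getD default)) <|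
        .load (fun v => (v.1, v.2.1, none)) <| .goto fun _ => .inr (.inr true))
      (.goto fun _ => .inr (.inl M₂.main))

/-- Popping one stack and pushing on another reverses the word. Going through the auxiliary stack
reverses it twice, so the second machine finds it in the right order. -/
theorem compProg_transfer_out (v₁ : M₁.σ) (v₂ : M₂.σ) (S₁ : ∀ k, List (M₁.Γ k))
    (S₂ : ∀ k, List (M₂.Γ k)) (x : List B) (T : List (Option B)) :
    StepsIn (TM2.step (compProg M₁ M₂ e₁ e₂))
      ⟨some (.inr (.inr false)), (v₁, v₂, none),
        compStk (Function.update S₁ M₁.k₁ (x.map e₁.symm)) S₂ T⟩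
      ⟨some (.inr (.inr true)), (v₁, v₂, none),
        compStk (Function.update S₁ M₁.k₁ []) S₂ ((x.map some).reverse ++ T)⟩ (x.length + 1) := by
  induction x generalizing T with
  | nil =>
    refine .single ?_
    simp [compProg, update_compStk_inl]
    simp [compStk]
  | cons b x ih =>
    have := ih (some b :: T)
    refine .head ?_ (by simpa using this)
    simp [compProg, update_compStk_inl, update_compStk_aux]
    simp [compStk]

theorem compProg_transfer_in (v₁ : M₁.σ) (v₂ : M₂.σ) (S₁ : ∀ k, List (M₁.Γ k))
    (S₂ : ∀ k, List (M₂.Γ k)) (x : List B) (T : List (M₂.Γ M₂.k₀)) :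
    StepsIn (TM2.step (compProg M₁ M₂ e₁ e₂))
      ⟨some (.inr (.inr true)), (v₁, v₂, none),
        compStk S₁ (Function.update S₂ M₂.k₀ T) (x.map some)⟩
      ⟨some (.inr (.inl M₂.main)), (v₁, v₂, none),
        compStk S₁ (Function.update S₂ M₂.k₀ ((x.map e₂.symm).reverse ++ T)) []⟩
        (x.length + 1) := by
  induction x generalizing T with
  | nil =>
    refine .single ?_
    simp [compProg, update_compStk_aux]
    simp [compStk]
  | cons b x ih =>
    have := ih (e₂.symm b :: T)
    refine .head ?_ (by simpa using this)
    simp [compProg, update_compStk_inr, update_compStk_aux]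
    simp [compStk]

/-- The configuration of the composition while the first machine is running. -/
def compEmbedFst (c : Cfg M₁.Γ M₁.Λ M₁.σ) :
    Cfg (CompΓ M₁ M₂ B) (CompLabel M₁ M₂) (CompState M₁ M₂ B) :=
  c.embed (Γ' := CompΓ M₁ M₂ B) (κ := Sum.inl) (fun v => (v, M₂.initialState, none))
    (fun T => compStk T (fun _ => []) []) Sum.inl (some (.inr (.inr false)))

/-- The configuration of the composition while the second machine is running. -/
def compEmbedSnd (c : Cfg M₂.Γ M₂.Λ M₂.σ) :
    Cfg (CompΓ M₁ M₂ B) (CompLabel M₁ M₂) (CompState M₁ M₂ B) :=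
  c.embed (Γ' := CompΓ M₁ M₂ B) (κ := fun k => Sum.inr (Sum.inl k))
    (fun v => (M₁.initialState, v, none)) (fun T => compStk (fun _ => []) T [])
    (fun l => Sum.inr (Sum.inl l)) none

theorem step_compEmbedFst (a b : Cfg M₁.Γ M₁.Λ M₁.σ) (h : TM2.step M₁.m a = some b) :
    TM2.step (compProg M₁ M₂ e₁ e₂) (compEmbedFst M₁ M₂ a) = some (compEmbedFst M₁ M₂ b) := by
  obtain ⟨l, v, S⟩ := a
  cases l with
  | none => cases h
  | some l =>
    obtain rfl := Option.some.inj h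
    exact congrArg some (TM2.stepAux_embed (Γ' := CompΓ M₁ M₂ B) (κ := Sum.inl)
      (get := fun v : CompState M₁ M₂ B => v.1) (set := fun v w => (w, v.2))
      (put := fun v => (v, M₂.initialState, none))
      (stk := fun T => compStk T (fun _ => []) [])
      (fun _ => rfl) (fun _ _ => rfl) (fun _ _ => rfl)
      (fun T k x => update_compStk_inl T _ _ k x) (M₁.m l) v S)

theorem step_compEmbedSnd (a b : Cfg M₂.Γ M₂.Λ M₂.σ) (h : TM2.step M₂.m a = some b) :
    TM2.step (compProg M₁ M₂ e₁ e₂) (compEmbedSnd M₁ M₂ a) = some (compEmbedSnd M₁ M₂ b) := by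
  obtain ⟨l, v, S⟩ := a
  cases l with
  | none => cases h
  | some l =>
    obtain rfl := Option.some.inj h
    exact congrArg some (TM2.stepAux_embed (Γ' := CompΓ M₁ M₂ B)
      (κ := fun k => Sum.inr (Sum.inl k)) (get := fun v : CompState M₁ M₂ B => v.2.1)
      (set := fun v w => (v.1, w, v.2.2)) (put := fun v => (M₁.initialState, v, none))
      (stk := fun T => compStk (fun _ => []) T [])
      (fun _ => rfl) (fun _ _ => rfl) (fun _ _ => rfl)
      (fun T k x => update_compStk_inr _ T _ k x) (M₂.m l) v S)

/-- The composition of two machines. -/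
noncomputable def compTM [Fintype B] : FinTM2 :=
  letI := M₁.kFin
  letI := M₂.kFin
  letI := M₁.ΛFin
  letI := M₂.ΛFin
  letI := M₁.σFin
  letI := M₂.σFin
  { K := M₁.K ⊕ M₂.K ⊕ Unit
    k₀ := .inl M₁.k₀
    k₁ := .inr (.inl M₂.k₁)
    Γ := CompΓ M₁ M₂ B
    Λ := CompLabel M₁ M₂
    main := .inl M₁.main
    σ := CompState M₁ M₂ B
    initialState := (M₁.initialState, M₂.initialState, none)
    Γk₀Fin := M₁.Γk₀Fin
    m := compProg M₁ M₂ e₁ e₂ }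

theorem compTM_run [Fintype B] {s : List (M₁.Γ M₁.k₀)} {x : List B} {y : List (M₂.Γ M₂.k₁)}
    {t₁ t₂ : ℕ}
    (h₁ : StepsIn M₁.step (initList M₁ s) (haltList M₁ (x.map e₁.symm)) t₁)
    (h₂ : StepsIn M₂.step (initList M₂ (x.map e₂.symm)) (haltList M₂ y) t₂) :
    StepsIn (compTM M₁ M₂ e₁ e₂).step (initList (compTM M₁ M₂ e₁ e₂) s)
      (haltList (compTM M₁ M₂ e₁ e₂) y) (t₁ + (x.length + 1) + (x.length + 1) + t₂) := by
  have r₁ : StepsIn (compTM M₁ M₂ e₁ e₂).step (compEmbedFst M₁ M₂ _) (compEmbedFst M₁ M₂ _) t₁ :=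
    h₁.map (compEmbedFst M₁ M₂) (step_compEmbedFst M₁ M₂ e₁ e₂)
  have r₂ : StepsIn (compTM M₁ M₂ e₁ e₂).step (compEmbedSnd M₁ M₂ _) (compEmbedSnd M₁ M₂ _) t₂ :=
    h₂.map (compEmbedSnd M₁ M₂) (step_compEmbedSnd M₁ M₂ e₁ e₂)
  have o := compProg_transfer_out M₁ M₂ e₁ e₂ M₁.initialState M₂.initialState (fun _ => [])
    (fun _ => []) x []
  have i := compProg_transfer_in M₁ M₂ e₁ e₂ M₁.initialState M₂.initialState (fun _ => [])
    (fun _ => []) x.reverse []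
  have a₁ : initList (compTM M₁ M₂ e₁ e₂) s = compEmbedFst M₁ M₂ (initList M₁ s) := by
    have : (initList (compTM M₁ M₂ e₁ e₂) s).stk = (compEmbedFst M₁ M₂ (initList M₁ s)).stk := by
      refine (initList_stk _ _).trans ?_
      change _ = compStk (initList M₁ s).stk (fun _ => []) []
      rw [initList_stk, ← update_compStk_inl]
      refine congrArg (fun S => Function.update S _ _) ?_
      funext k
      rcases k with k | k | k <;> rfl
    exact congrArg (Cfg.mk _ _) this
  have a₂ : haltList (compTM M₁ M₂ e₁ e₂) y = compEmbedSnd M₁ M₂ (haltList M₂ y) := by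
    have : (haltList (compTM M₁ M₂ e₁ e₂) y).stk = (compEmbedSnd M₁ M₂ (haltList M₂ y)).stk := by
      refine (haltList_stk _ _).trans ?_
      change _ = compStk (fun _ => []) (haltList M₂ y).stk []
      rw [haltList_stk, ← update_compStk_inr]
      refine congrArg (fun S => Function.update S _ _) ?_
      funext k
      rcases k with k | k | k <;> rfl
    exact congrArg (Cfg.mk _ _) this
  have b₁ : compEmbedFst M₁ M₂ (B := B) (haltList M₁ (x.map e₁.symm)) =
      ⟨some (.inr (.inr false)), (M₁.initialState, M₂.initialState, none),
        compStk (Function.update (fun _ => []) M₁.k₁ (x.map e₁.symm)) (fun _ => []) []⟩ :=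
    congrArg (fun S => Cfg.mk _ _ (compStk (B := B) S (fun _ => []) [])) (haltList_stk M₁ _)
  have b₂ : compEmbedSnd M₁ M₂ (B := B) (initList M₂ (x.map e₂.symm)) =
      ⟨some (.inr (.inl M₂.main)), (M₁.initialState, M₂.initialState, none),
        compStk (fun _ => []) (Function.update (fun _ => []) M₂.k₀ (x.map e₂.symm)) []⟩ :=
    congrArg (fun S => Cfg.mk _ _ (compStk (B := B) (fun _ => []) S [])) (initList_stk M₂ _)
  rw [← b₁] at o
  -- The two reversals cancel here.
  simp only [List.map_reverse, List.reverse_reverse, List.append_nil, List.length_reverse] at i o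
  rw [← b₂] at i
  rw [Function.update_eq_self_iff.2 rfl] at i o
  rw [a₁, a₂]
  exact ((r₁.trans o).trans i).trans r₂

end Comp

/-- The composition of two functions that are computable in polynomial time. -/
theorem TM2ComputableInPolyTime.comp {α β γ A B C : Type} [Fintype B] [Inhabited B]
    {ea : α → List A} {eb : β → List B} {ec : γ → List C} {f : α → β} {g : β → γ}
    (h₁ : TM2ComputableInPolyTime ea eb f) (h₂ : TM2ComputableInPolyTime eb ec g) :
    Nonempty (TM2ComputableInPolyTime ea ec (g ∘ f)) := by
  let _ := h₁.tm.ΛFin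
  let c : ℕ := ∑ l, (h₁.tm.m l).size
  -- A bound for the length of the intermediate word: what may already be on the stack, plus at most
  -- `c` pushes in each step of the first machine.
  let len : Polynomial ℕ := Polynomial.X + h₁.time * Polynomial.C c
  -- Monotonicity lets `len` replace the actual length of the intermediate word in the time bound of
  -- the second machine.
  have mono (p : Polynomial ℕ) : Monotone fun n => p.eval n := by
    intro a b hab
    simp only [Polynomial.eval_eq_sum]
    exact Finset.sum_le_sum fun i _ => Nat.mul_le_mul_left _ (Nat.pow_le_pow_left hab i)
  refine ⟨⟨⟨compTM h₁.tm h₂.tm h₁.outputAlphabet h₂.inputAlphabet, h₁.inputAlphabet,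
    h₂.outputAlphabet⟩, h₁.time + (len + 1) + (len + 1) + h₂.time.comp len, fun a => ?_⟩⟩
  obtain ⟨⟨s₁, r₁⟩, b₁⟩ := h₁.outputsFun a
  obtain ⟨⟨s₂, r₂⟩, b₂⟩ := h₂.outputsFun (f a)
  have q₁ := StepsIn.of_iterate_eq r₁
  have q₂ := StepsIn.of_iterate_eq r₂
  have run := compTM_run h₁.tm h₂.tm h₁.outputAlphabet h₂.inputAlphabet q₁ q₂
  have hlen : (eb (f a)).length ≤ len.eval (ea a).length := by
    have h := TM2.length_stk_le h₁.tm.m q₁ h₁.tm.k₁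
    rw [haltList_stk, initList_stk] at h
    simp only [Function.update_self, List.length_map] at h
    refine h.trans ?_
    simp only [len, Polynomial.eval_add, Polynomial.eval_X, Polynomial.eval_mul,
      Polynomial.eval_C]
    refine Nat.add_le_add ?_ (Nat.mul_le_mul_right _ b₁)
    -- The output stack may coincide with the input stack, and then it starts out holding the input;
    -- this is the summand `X` of `len`.
    by_cases h : h₁.tm.k₁ = h₁.tm.k₀
    · rw [h]; simp
    · rw [Function.update_of_ne h]; simp
  refine ⟨⟨_, run.iterate_eq⟩, ?_⟩
  simp only [Polynomial.eval_add, Polynomial.eval_one, Polynomial.eval_comp]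
  have := b₂.trans (mono h₂.time hlen)
  change s₁ ≤ _ at b₁
  change s₂ ≤ h₂.time.eval (len.eval _) at this
  omega

/-! ### Structured programs with counters -/

/-- Structured programs for a machine that reads a word over `A` from an input stack, writes
a word over `B` on an output stack, and has a family `C` of counters and a register in `R`. -/
inductive Prog (A B C R : Type) where
  | write (f : R → B)
  | read (f : R → Option A → R)
  | load (f : R → R)
  | inc (c : C)
  | seq (p q : Prog A B C R)
  | ite (b : R → Bool) (p q : Prog A B C R)
  | whileInp (b : Option A → Bool) (p : Prog A B C R)
  | whileCtr (c : C) (p : Prog A B C R)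

/-- The states of a program. -/
structure PState (A B C R : Type) where
  reg : R
  inp : List A
  out : List B
  ctr : C → ℕ

namespace Prog

variable {A B C R : Type}

section Exec

variable [DecidableEq C]

/-- `Exec p s s' t`: the program `p`, started in `s`, ends in `s'` after `t` steps. The loop
`whileCtr c p` decrements the counter `c` before each execution of `p`, until `c` is zero. -/
inductive Exec : Prog A B C R → PState A B C R → PState A B C R → ℕ → Prop
  | write (f s) : Exec (.write f) s { s with out := f s.reg :: s.out } 1
  | read (f s) : Exec (.read f) s { s with reg := f s.reg s.inp.head?, inp := s.inp.tail } 1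
  | load (f s) : Exec (.load f) s { s with reg := f s.reg } 1
  | inc (c s) : Exec (.inc c) s { s with ctr := Function.update s.ctr c (s.ctr c + 1) } 1
  | seq {p q s s' s'' t t'} : Exec p s s' t → Exec q s' s'' t' → Exec (.seq p q) s s'' (t + t')
  | ite_true {b p q s s' t} : b s.reg = true → Exec p s s' t → Exec (.ite b p q) s s' (t + 1)
  | ite_false {b p q s s' t} : b s.reg = false → Exec q s s' t → Exec (.ite b p q) s s' (t + 1)
  | whileInp_done {b p s} : b s.inp.head? = false → Exec (.whileInp b p) s s 1
  | whileInp_step {b p s s' s'' t t'} : b s.inp.head? = true → Exec p s s' t →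
      Exec (.whileInp b p) s' s'' t' → Exec (.whileInp b p) s s'' (t + t' + 1)
  | whileCtr_done {c p s} : s.ctr c = 0 → Exec (.whileCtr c p) s s 1
  | whileCtr_step {c p n s s' s'' t t'} : s.ctr c = n + 1 →
      Exec p { s with ctr := Function.update s.ctr c n } s' t →
      Exec (.whileCtr c p) s' s'' t' → Exec (.whileCtr c p) s s'' (t + t' + 1)

end Exec

/-- The labels of the machine for a program. -/
def Label : Prog A B C R → Type
  | .write _ => Unit
  | .read _ => Unit
  | .load _ => Unit
  | .inc _ => Unit
  | .seq p q => Label p ⊕ Label q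
  | .ite _ p q => Option (Label p ⊕ Label q)
  | .whileInp _ p => Option (Label p)
  | .whileCtr _ p => Option (Label p)

/-- A program has finitely many labels. -/
@[reducible]
def labelFintype : (p : Prog A B C R) → Fintype (Label p)
  | .write _ => inferInstanceAs (Fintype Unit)
  | .read _ => inferInstanceAs (Fintype Unit)
  | .load _ => inferInstanceAs (Fintype Unit)
  | .inc _ => inferInstanceAs (Fintype Unit)
  | .seq p q =>
    letI := labelFintype p
    letI := labelFintype q
    inferInstanceAs (Fintype (Label p ⊕ Label q))
  | .ite _ p q =>
    letI := labelFintype p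
    letI := labelFintype q
    inferInstanceAs (Fintype (Option (Label p ⊕ Label q)))
  | .whileInp _ p =>
    letI := labelFintype p
    inferInstanceAs (Fintype (Option (Label p)))
  | .whileCtr _ p =>
    letI := labelFintype p
    inferInstanceAs (Fintype (Option (Label p)))

/-- The label where a program starts. -/
def entry : (p : Prog A B C R) → Label p
  | .write _ => ()
  | .read _ => ()
  | .load _ => ()
  | .inc _ => ()
  | .seq p _ => Sum.inl (entry p)
  | .ite _ _ _ => (none : Option _)
  | .whileInp _ _ => (none : Option _)
  | .whileCtr _ _ => (none : Option _)

/-- The stack alphabets: `none` is the input stack, `some none` is the output stack, and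
`some (some c)` is the counter `c`. -/
abbrev StackΓ (A B C : Type) : Option (Option C) → Type
  | none => A
  | some none => B
  | some (some _) => Unit

/-- The stacks that represent a state. -/
def PState.stk (inp : List A) (out : List B) (ctr : C → ℕ) : ∀ k, List (StackΓ A B C k)
  | none => inp
  | some none => out
  | some (some c) => List.replicate (ctr c) ()

/-- The statements for a program that is part of a machine with labels `L`. The internal state
consists of the register and of a flag, which is `false` outside the tests of the loops. -/
def code {L : Type} : (p : Prog A B C R) → (Label p → L) → L → Label p →
    Stmt (StackΓ A B C) L (R × Bool)
  | .write f, _, exit, _ => .push (some none) (fun v => f v.1) <| .goto fun _ => exit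
  | .read f, _, exit, _ => .pop none (fun v o => (f v.1 o, v.2)) <| .goto fun _ => exit
  | .load f, _, exit, _ => .load (fun v => (f v.1, v.2)) <| .goto fun _ => exit
  | .inc c, _, exit, _ => .push (some (some c)) (fun _ => ()) <| .goto fun _ => exit
  | .seq p q, emb, exit, l =>
    match l with
    | .inl l => code p (fun l => emb (Sum.inl l)) (emb (Sum.inr (entry q))) l
    | .inr l => code q (fun l => emb (Sum.inr l)) exit l
  | .ite b p q, emb, exit, l =>
    match l with
    | none => .goto fun v =>
      bif b v.1 then emb (some (Sum.inl (entry p))) else emb (some (Sum.inr (entry q)))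
    | some (.inl l) => code p (fun l => emb (some (Sum.inl l))) exit l
    | some (.inr l) => code q (fun l => emb (some (Sum.inr l))) exit l
  | .whileInp b p, emb, exit, l =>
    match l with
    | none => .peek none (fun v o => (v.1, b o)) <| .branch (fun v => v.2)
        (.load (fun v => (v.1, false)) <| .goto fun _ => emb (some (entry p)))
        (.goto fun _ => exit)
    | some l => code p (fun l => emb (some l)) (emb (none : Option _)) l
  | .whileCtr c p, emb, exit, l =>
    match l with
    | none => .pop (some (some c)) (fun v o => (v.1, o.isSome)) <| .branch (fun v => v.2)
        (.load (fun v => (v.1, false)) <| .goto fun _ => emb (some (entry p)))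
        (.goto fun _ => exit)
    | some l => code p (fun l => emb (some l)) (emb (none : Option _)) l

variable [DecidableEq C]

theorem update_stk_inp (inp x : List A) (out : List B) (ctr : C → ℕ) :
    Function.update (PState.stk inp out ctr) none x = PState.stk x out ctr := by
  funext k
  rcases k with _ | _ | k <;> simp [PState.stk]

theorem update_stk_out (inp : List A) (out x : List B) (ctr : C → ℕ) :
    Function.update (PState.stk inp out ctr) (some none) x = PState.stk inp x ctr := by
  funext k
  rcases k with _ | _ | k <;> simp [PState.stk]

theorem update_stk_ctr (inp : List A) (out : List B) (ctr : C → ℕ) (c : C) (n : ℕ) :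
    Function.update (PState.stk inp out ctr) (some (some c)) (List.replicate n ()) =
      PState.stk inp out (Function.update ctr c n) := by
  funext k
  rcases k with _ | _ | k
  · simp [PState.stk]
  · simp [PState.stk]
  · by_cases h : k = c
    · subst h; simp [PState.stk]
    · simp [PState.stk, h]

/-- The configuration with label `l` that represents a state. -/
def PState.cfg {L : Type} (l : L) (s : PState A B C R) : Cfg (StackΓ A B C) L (R × Bool) :=
  ⟨some l, (s.reg, false), PState.stk s.inp s.out s.ctr⟩

/-- The time in `Exec` counts machine steps exactly: one for each primitive and each test, none for
sequencing, since the exit label of the first part is the entry of the second. Quantifying over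
`emb` and `exit` inside an arbitrary machine lets the induction enter subprograms. -/
theorem Exec.stepsIn {L : Type} {M : L → Stmt (StackΓ A B C) L (R × Bool)}
    {p : Prog A B C R} {s s' : PState A B C R} {t : ℕ} (h : Exec p s s' t) :
    ∀ (emb : Label p → L) (exit : L), (∀ l, M (emb l) = code p emb exit l) →
      StepsIn (TM2.step M) (PState.cfg (emb (entry p)) s) (PState.cfg exit s') t := by
  induction h with
  | write f s =>
    intro emb exit hM
    refine .single ?_
    simp [PState.cfg, hM, code, update_stk_out]
    rfl
  | read f s =>
    intro emb exit hM
    refine .single ?_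
    simp [PState.cfg, hM, code, update_stk_inp, PState.stk]
  | load f s =>
    intro emb exit hM
    refine .single ?_
    simp [PState.cfg, hM, code]
  | inc c s =>
    intro emb exit hM
    refine .single ?_
    simp only [PState.cfg, TM2.step, hM, code, stepAux]
    rw [← update_stk_ctr]
    rfl
  | @seq p q _ _ _ _ _ _ _ ih₁ ih₂ =>
    intro emb exit hM
    exact (ih₁ (fun l => emb (Sum.inl l)) (emb (Sum.inr (entry q))) fun l => hM (Sum.inl l)).trans
      (ih₂ (fun l => emb (Sum.inr l)) exit fun l => hM (Sum.inr l))
  | @ite_true b p q s _ _ hb _ ih =>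
    intro emb exit hM
    refine .head ?_ (ih (fun l => emb (some (Sum.inl l))) exit fun l => hM (some (Sum.inl l)))
    have := hM none
    simp only [entry, PState.cfg, TM2.step]
    rw [this]
    simp [code, hb]
  | @ite_false b p q s _ _ hb _ ih =>
    intro emb exit hM
    refine .head ?_ (ih (fun l => emb (some (Sum.inr l))) exit fun l => hM (some (Sum.inr l)))
    have := hM none
    simp only [entry, PState.cfg, TM2.step]
    rw [this]
    simp [code, hb]
  | @whileInp_done b p s hb =>
    intro emb exit hM
    refine .single ?_
    have := hM none
    simp only [entry, PState.cfg, TM2.step]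
    rw [this]
    simp [code, PState.stk, hb]
  | @whileInp_step b p s _ _ _ _ hb _ _ ih₁ ih₂ =>
    intro emb exit hM
    refine .head ?_ ((ih₁ (fun l => emb (some l)) (emb (none : Option _))
      fun l => hM (some l)).trans (ih₂ emb exit hM))
    have := hM none
    simp only [entry, PState.cfg, TM2.step]
    rw [this]
    simp [code, PState.stk, hb]
  | @whileCtr_done c p s hc =>
    intro emb exit hM
    refine .single ?_
    have := hM none
    simp only [entry, PState.cfg, TM2.step]
    rw [this]
    simp [code, PState.stk, hc]
  | @whileCtr_step c p n s _ _ _ _ hc _ _ ih₁ ih₂ =>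
    intro emb exit hM
    refine .head ?_ ((ih₁ (fun l => emb (some l)) (emb (none : Option _))
      fun l => hM (some l)).trans (ih₂ emb exit hM))
    have := hM none
    simp only [entry, PState.cfg, TM2.step]
    rw [this, ← update_stk_ctr]
    simp [code, PState.stk, hc, List.replicate_succ]

/-- The machine for a program. -/
def toTM [Fintype A] [Fintype C] [Fintype R] (p : Prog A B C R) (r : R) : FinTM2 :=
  letI := labelFintype p
  { K := Option (Option C)
    k₀ := none
    k₁ := some none
    Γ := StackΓ A B C
    Λ := Option (Label p)
    main := some (entry p)
    σ := R × Bool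
    initialState := (r, false)
    Γk₀Fin := ‹Fintype A›
    m := fun l => l.elim .halt (code p some none) }

/-- A function is computable in polynomial time if there is a program for it. -/
theorem tm2ComputableInPolyTime [Fintype A] [Fintype C] [Fintype R] {α β : Type}
    {ea : α → List A} {eb : β → List B} {f : α → β} (p : Prog A B C R) (r : R)
    (time : Polynomial ℕ)
    (h : ∀ a, ∃ t, Exec p ⟨r, ea a, [], fun _ => 0⟩ ⟨r, [], eb (f a), fun _ => 0⟩ t ∧
      t + 1 ≤ time.eval (ea a).length) :
    Nonempty (TM2ComputableInPolyTime ea eb f) := by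
  refine ⟨⟨⟨p.toTM r, Equiv.refl _, Equiv.refl _⟩, time, fun a => ?_⟩⟩
  choose t ht using h
  have run : StepsIn (p.toTM r).step (PState.cfg _ _) (PState.cfg _ _) (t a) :=
    (ht a).1.stepsIn (M := (p.toTM r).m) some none fun _ => rfl
  have e₁ : initList (p.toTM r) (ea a) =
      PState.cfg (some (entry p)) ⟨r, ea a, [], fun _ => 0⟩ := by
    have : (initList (p.toTM r) (ea a)).stk = PState.stk (ea a) [] fun _ => 0 := by
      refine (initList_stk _ _).trans ?_
      refine Eq.trans ?_ (update_stk_inp [] (ea a) [] fun _ => 0)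
      refine congrArg (fun S => Function.update S _ _) ?_
      funext k
      rcases k with _ | _ | k <;> rfl
    exact congrArg (Cfg.mk _ _) this
  -- The exit label `none` carries the halt statement, whence the `+ 1` in the time bound. The final
  -- configuration must have the initial register and empty stacks apart from the output, so
  -- programs have to clean up.
  have e₂ : TM2.step (p.toTM r).m (PState.cfg none ⟨r, [], eb (f a), fun _ => 0⟩) =
      some (haltList (p.toTM r) (eb (f a))) := by
    have : (haltList (p.toTM r) (eb (f a))).stk = PState.stk [] (eb (f a)) fun _ => 0 := by
      refine (haltList_stk _ _).trans ?_
      refine Eq.trans ?_ (update_stk_out [] [] (eb (f a)) fun _ => 0)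
      refine congrArg (fun S => Function.update S _ _) ?_
      funext k
      rcases k with _ | _ | k <;> rfl
    exact congrArg (fun S => some (Cfg.mk _ _ S)) this.symm
  have run' : StepsIn (p.toTM r).step (initList (p.toTM r) (ea a)) (haltList (p.toTM r) (eb (f a)))
      (t a + 1) :=
    Eq.subst (motive := fun c => StepsIn (p.toTM r).step c _ (t a + 1)) e₁.symm
      (run.trans (.single e₂))
  have e₃ (l : List A) : List.map (Equiv.refl A).invFun l = l := List.map_id l
  have e₄ (l : List B) : List.map (Equiv.refl B).invFun l = l := List.map_id l
  refine ⟨⟨t a + 1, ?_⟩, (ht a).2⟩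
  refine Eq.trans ?_ (run'.iterate_eq.trans ?_)
  · exact congrArg (fun x => (flip bind (p.toTM r).step)^[t a + 1] (some (initList (p.toTM r) x)))
      (e₃ (ea a))
  · exact congrArg (fun x => some (haltList (p.toTM r) x)) (e₄ (eb (f a))).symm

end Prog

end Turing

/-! ### The cubic polynomial of a circuit -/

namespace BoolCircuit

/-- The monomials for the gate whose output is the wire `k - 1`. The wire `i` has the four variables
`4 * (i + 1) + c`: for `c = 1` its value, for `c = 0` a copy of the first input of the gate, for
`c = 2` and `c = 3` the multipliers of the equations for the copy and for the value. -/
def gateMonomials (k : ℕ) : BoolGate → List (List ℕ)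
  | .and i j => [[4 * i + 5, 4 * k + 2], [4 * k, 4 * k + 2], [4 * k + 1, 4 * k + 3],
      [4 * j + 5, 4 * k, 4 * k + 3]]
  | .or i j => [[4 * i + 5, 4 * k + 2], [4 * k, 4 * k + 2], [4 * k + 1, 4 * k + 3],
      [4 * j + 5, 4 * k, 4 * k + 3], [4 * k, 4 * k + 3], [4 * j + 5, 4 * k + 3]]
  | .not i => [[4 * i + 5, 4 * k + 2], [4 * k, 4 * k + 2], [4 * k + 1, 4 * k + 3],
      [4 * k, 4 * k + 3], [4 * k + 3]]

/-- The monomials for a list of gates. -/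
def gatesMonomials : ℕ → List BoolGate → List (List ℕ)
  | _, [] => []
  | k, g :: gs => gatesMonomials (k + 1) gs ++ gateMonomials k g

/-- The monomials for an input wire: it is `0` unless the variable `0` is `1`. -/
def inputMonomials (k : ℕ) : List (List ℕ) :=
  [[4 * k, 4 * k + 2], [0, 4 * k + 1, 4 * k + 3], [4 * k + 1, 4 * k + 3]]

/-- The monomials for `n` input wires. -/
def inputsMonomials : ℕ → ℕ → List (List ℕ)
  | _, 0 => []
  | k, n + 1 => inputsMonomials (k + 1) n ++ inputMonomials k

/-- The monomials that are independent of the circuit. -/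
def baseMonomials : List (List ℕ) := [[0, 2], [0, 1, 3], [1, 3]]

/-- All monomials of the polynomial of a circuit. -/
def natMonomials (C : BoolCircuit) : List (List ℕ) :=
  gatesMonomials (C.numInputs + 1) C.gates ++
    ([[0, 2, 4 * C.out + 5]] ++ (inputsMonomials 1 C.numInputs ++ baseMonomials))

/-- The number of variables of the polynomial of a circuit. -/
def polyVars (C : BoolCircuit) : ℕ := 4 * (C.numInputs + C.gates.length + 1)

/-- The gates are well-formed if the first one computes the wire `w`. -/
def GatesWf (w : ℕ) (gs : List BoolGate) : Prop :=
  ∀ (k : ℕ) (hk : k < gs.length), ∀ i ∈ (gs[k]).inputs, i < w + k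

theorem GatesWf.head {w : ℕ} {g : BoolGate} {gs : List BoolGate} (h : GatesWf w (g :: gs)) :
    ∀ i ∈ g.inputs, i < w := fun i hi => h 0 (by simp) i hi

theorem GatesWf.tail {w : ℕ} {g : BoolGate} {gs : List BoolGate} (h : GatesWf w (g :: gs)) :
    GatesWf (w + 1) gs := fun k hk i hi => by
  have := h (k + 1) (by simpa using hk) i (by simpa using hi)
  omega

/-! #### Shape of the monomials -/

/-- The shape of the monomials that are used in the blocks from `a` to `b - 1`. -/
def IsBlockMonomial (a b : ℕ) (m : List ℕ) : Prop :=
  m.Pairwise (· < ·) ∧ m.length ≤ 3 ∧ (∀ i ∈ m, i < 4 * b) ∧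
    ∃ l ∈ m, 4 * a ≤ l ∧ 2 ≤ l % 4 ∧ ∀ i ∈ m, i ≤ l

theorem IsBlockMonomial.mono {a b a' b' : ℕ} {m : List ℕ} (h : IsBlockMonomial a b m)
    (ha : a' ≤ a) (hb : b ≤ b') : IsBlockMonomial a' b' m := by
  obtain ⟨h₁, h₂, h₃, l, hl, h₄, h₅, h₆⟩ := h
  exact ⟨h₁, h₂, fun i hi => (h₃ i hi).trans_le (by omega), l, hl, by omega, h₅, h₆⟩

/-- The largest variable of a monomial tells its block. For consecutive ranges of blocks the
conclusion is absurd, so their monomials are disjoint. -/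
theorem IsBlockMonomial.lt {a b a' b' : ℕ} {m : List ℕ} (h : IsBlockMonomial a b m)
    (h' : IsBlockMonomial a' b' m) : a < b' := by
  obtain ⟨l, hl, h₄, -⟩ := h.2.2.2
  have := h'.2.2.1 l hl
  omega

theorem isBlockMonomial_gate {k : ℕ} {g : BoolGate} (h : ∀ i ∈ g.inputs, i + 1 < k) :
    ∀ m ∈ gateMonomials k g, IsBlockMonomial k (k + 1) m := by
  have key : ∀ m l, m.Pairwise (· < ·) → m.length ≤ 3 → l ∈ m → l = 4 * k + 2 ∨ l = 4 * k + 3 →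
      (∀ i ∈ m, i ≤ l) → IsBlockMonomial k (k + 1) m := fun m l h₁ h₂ h₃ h₄ h₅ =>
    ⟨h₁, h₂, fun i hi => by have := h₅ i hi; omega, l, h₃, by omega, by omega, h₅⟩
  have k2 : ∀ x, x < 4 * k + 2 → IsBlockMonomial k (k + 1) [x, 4 * k + 2] := fun x hx =>
    key _ (4 * k + 2) (by simpa using hx) (by simp) (by simp) (by simp) (by simp; omega)
  have k3 : ∀ x, x < 4 * k + 3 → IsBlockMonomial k (k + 1) [x, 4 * k + 3] := fun x hx =>
    key _ (4 * k + 3) (by simpa using hx) (by simp) (by simp) (by simp) (by simp; omega)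
  have k33 : ∀ x, x < 4 * k → IsBlockMonomial k (k + 1) [x, 4 * k, 4 * k + 3] := fun x hx =>
    key _ (4 * k + 3) (by simp; omega) (by simp) (by simp) (by simp) (by simp; omega)
  have k1 : IsBlockMonomial k (k + 1) [4 * k + 3] :=
    key _ (4 * k + 3) (by simp) (by simp) (by simp) (by simp) (by simp)
  cases g with
  | and i j =>
    simp only [BoolGate.inputs, List.mem_cons, List.not_mem_nil, or_false, forall_eq_or_imp,
      forall_eq] at h
    simp only [gateMonomials, List.mem_cons, List.not_mem_nil, or_false, forall_eq_or_imp,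
      forall_eq]
    exact ⟨k2 _ (by omega), k2 _ (by omega), k3 _ (by omega), k33 _ (by omega)⟩
  | or i j =>
    simp only [BoolGate.inputs, List.mem_cons, List.not_mem_nil, or_false, forall_eq_or_imp,
      forall_eq] at h
    simp only [gateMonomials, List.mem_cons, List.not_mem_nil, or_false, forall_eq_or_imp,
      forall_eq]
    exact ⟨k2 _ (by omega), k2 _ (by omega), k3 _ (by omega), k33 _ (by omega), k3 _ (by omega),
      k3 _ (by omega)⟩
  | not i =>
    simp only [BoolGate.inputs, List.mem_cons, List.not_mem_nil, or_false, forall_eq] at h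
    simp only [gateMonomials, List.mem_cons, List.not_mem_nil, or_false, forall_eq_or_imp,
      forall_eq]
    exact ⟨k2 _ (by omega), k2 _ (by omega), k3 _ (by omega), k3 _ (by omega), k1⟩

theorem nodup_gateMonomials {k : ℕ} {g : BoolGate} (h : ∀ i ∈ g.inputs, i + 1 < k) :
    (gateMonomials k g).Nodup := by
  cases g
  all_goals
    simp [gateMonomials, BoolGate.inputs] at h ⊢
    try omega

theorem isBlockMonomial_input (k : ℕ) :
    ∀ m ∈ inputMonomials k, IsBlockMonomial k (k + 1) m := by
  simp only [inputMonomials, List.mem_cons, List.not_mem_nil, or_false, forall_eq_or_imp,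
    forall_eq]
  refine ⟨⟨by simp, by simp, by simp; omega, 4 * k + 2, ?_⟩,
    ⟨by simp, by simp, by simp; omega, 4 * k + 3, ?_⟩,
    ⟨by simp, by simp, by simp; omega, 4 * k + 3, ?_⟩⟩
  all_goals
    exact ⟨by simp, by omega, by omega, by simp⟩

theorem nodup_inputMonomials (k : ℕ) : (inputMonomials k).Nodup := by
  simp [inputMonomials]

theorem isBlockMonomial_gates {w : ℕ} {gs : List BoolGate} (h : GatesWf w gs) :
    ∀ m ∈ gatesMonomials (w + 1) gs, IsBlockMonomial (w + 1) (w + 1 + gs.length) m := by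
  induction gs generalizing w with
  | nil => simp [gatesMonomials]
  | cons g gs ih =>
    intro m hm
    rw [gatesMonomials, List.mem_append] at hm
    rcases hm with hm | hm
    · exact (ih h.tail m hm).mono (by omega) (by simp; omega)
    · refine (isBlockMonomial_gate (fun i hi => ?_) m hm).mono le_rfl (by simp)
      have := h.head i hi
      omega

theorem nodup_gatesMonomials {w : ℕ} {gs : List BoolGate} (h : GatesWf w gs) :
    (gatesMonomials (w + 1) gs).Nodup := by
  induction gs generalizing w with
  | nil => simp [gatesMonomials]
  | cons g gs ih =>
    have hg : ∀ i ∈ g.inputs, i + 1 < w + 1 := fun i hi => by have := h.head i hi; omega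
    refine List.Nodup.append (ih h.tail) (nodup_gateMonomials hg) fun m h₁ h₂ => ?_
    have := (isBlockMonomial_gates h.tail m h₁).lt (isBlockMonomial_gate hg m h₂)
    omega

theorem isBlockMonomial_inputs (k n : ℕ) :
    ∀ m ∈ inputsMonomials k n, IsBlockMonomial k (k + n) m := by
  induction n generalizing k with
  | zero => simp [inputsMonomials]
  | succ n ih =>
    intro m hm
    rw [inputsMonomials, List.mem_append] at hm
    rcases hm with hm | hm
    · exact (ih (k + 1) m hm).mono (by omega) (by omega)
    · exact (isBlockMonomial_input k m hm).mono le_rfl (by omega)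

theorem nodup_inputsMonomials (k n : ℕ) : (inputsMonomials k n).Nodup := by
  induction n generalizing k with
  | zero => simp [inputsMonomials]
  | succ n ih =>
    refine List.Nodup.append (ih (k + 1)) (nodup_inputMonomials k) fun m h₁ h₂ => ?_
    have := (isBlockMonomial_inputs (k + 1) n m h₁).lt (isBlockMonomial_input k m h₂)
    omega

theorem isBlockMonomial_base : ∀ m ∈ baseMonomials, IsBlockMonomial 0 1 m := by
  simp only [baseMonomials, List.mem_cons, List.not_mem_nil, or_false, forall_eq_or_imp, forall_eq]
  refine ⟨⟨by simp, by simp, by simp, 2, by simp⟩, ⟨by simp, by simp, by simp, 3, by simp⟩,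
    ⟨by simp, by simp, by simp, 3, by simp⟩⟩

theorem isBlockMonomial_or_mem (C : BoolCircuit) :
    ∀ m ∈ C.natMonomials, IsBlockMonomial 0 (C.numInputs + C.gates.length + 1) m ∨
      m = [0, 2, 4 * C.out + 5] := by
  intro m hm
  simp only [natMonomials, List.mem_append, List.mem_singleton] at hm
  rcases hm with hm | hm | hm | hm
  · exact .inl ((isBlockMonomial_gates C.gates_wf m hm).mono (by omega) (by omega))
  · exact .inr hm
  · exact .inl ((isBlockMonomial_inputs 1 _ m hm).mono (by omega) (by omega))
  · exact .inl ((isBlockMonomial_base m hm).mono le_rfl (by omega))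

/-- A block monomial ends in a multiplier, whose residue modulo `4` is `2` or `3`; the output
monomial ends in a wire value, of residue `1`. -/
theorem not_isBlockMonomial_out (o a b : ℕ) : ¬ IsBlockMonomial a b [0, 2, 4 * o + 5] := by
  rintro ⟨-, -, -, l, hl, h₁, h₂, h₃⟩
  simp only [List.mem_cons, List.not_mem_nil, or_false, forall_eq_or_imp, forall_eq] at hl h₃
  omega

theorem nodup_natMonomials (C : BoolCircuit) : C.natMonomials.Nodup := by
  have hb := isBlockMonomial_base
  have hi := isBlockMonomial_inputs 1 C.numInputs
  have hg := isBlockMonomial_gates C.gates_wf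
  refine List.Nodup.append (nodup_gatesMonomials C.gates_wf) (List.Nodup.append (by simp)
    (List.Nodup.append (nodup_inputsMonomials 1 _) (by simp [baseMonomials])
      fun m h₁ h₂ => ?_) fun m h₁ h₂ => ?_) fun m h₁ h₂ => ?_
  · have := (hi m h₁).lt (hb m h₂)
    omega
  · rw [List.mem_singleton] at h₁
    subst h₁
    rcases List.mem_append.1 h₂ with h₂ | h₂
    · exact not_isBlockMonomial_out _ _ _ (hi _ h₂)
    · exact not_isBlockMonomial_out _ _ _ (hb _ h₂)
  · simp only [List.mem_append, List.mem_singleton] at h₂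
    rcases h₂ with h₂ | h₂ | h₂
    · subst h₂
      exact not_isBlockMonomial_out _ _ _ (hg _ h₁)
    · have := (hg m h₁).lt (hi m h₂)
      omega
    · have := (hg m h₁).lt (hb m h₂)
      omega

theorem pairwise_natMonomials (C : BoolCircuit) : ∀ m ∈ C.natMonomials, m.Pairwise (· < ·) := by
  intro m hm
  rcases C.isBlockMonomial_or_mem m hm with h | rfl
  · exact h.1
  · simp

theorem length_natMonomials_le (C : BoolCircuit) : ∀ m ∈ C.natMonomials, m.length ≤ 3 := by
  intro m hm
  rcases C.isBlockMonomial_or_mem m hm with h | rfl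
  · exact h.2.1
  · simp

theorem lt_polyVars (C : BoolCircuit) : ∀ m ∈ C.natMonomials, ∀ i ∈ m, i < C.polyVars := by
  intro m hm
  have := C.out_wf
  rcases C.isBlockMonomial_or_mem m hm with h | rfl
  · exact h.2.2.1
  · simp [polyVars]
    omega

instance (C : BoolCircuit) : NeZero C.polyVars := ⟨by simp [polyVars]⟩

/-- All variable numbers are below `C.polyVars`, so the reduction in `Fin.ofNat` changes nothing. -/
theorem map_val_ofNat (C : BoolCircuit) {m : List ℕ} (hm : m ∈ C.natMonomials) :
    (m.map (Fin.ofNat C.polyVars)).map Fin.val = m := by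
  rw [List.map_map]
  conv_rhs => rw [← List.map_id m]
  refine List.map_congr_left fun i hi => ?_
  exact Nat.mod_eq_of_lt (C.lt_polyVars m hm i hi)

/-- The polynomial of a circuit. -/
def toF2Poly (C : BoolCircuit) : F2Poly where
  numVars := C.polyVars
  monomials := C.natMonomials.map fun m => m.map (Fin.ofNat C.polyVars)
  increasing := by
    simp only [List.mem_map, forall_exists_index, and_imp, forall_apply_eq_imp_iff₂]
    intro m hm
    have h := C.pairwise_natMonomials m hm
    rw [← C.map_val_ofNat hm, List.pairwise_map] at h
    exact h
  nodup := by
    refine List.Nodup.map_on (fun m hm m' hm' h => ?_) C.nodup_natMonomials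
    rw [← C.map_val_ofNat hm, h, C.map_val_ofNat hm']

end BoolCircuit

/-! ### Monomials do not cancel, and the total degree -/

namespace F2Poly

open MvPolynomial

theorem prod_map_X {n : ℕ} (m : List (Fin n)) :
    (m.map (X : Fin n → MvPolynomial (Fin n) (ZMod 2))).prod =
      monomial (Multiset.toFinsupp (m : Multiset (Fin n))) 1 := by
  induction m with
  | nil => simp
  | cons i m ih =>
    rw [List.map_cons, List.prod_cons, ih, X, monomial_mul, one_mul, ← Multiset.cons_coe,
      ← Multiset.singleton_add, map_add, Multiset.toFinsupp_singleton]

/-- A strictly increasing list is determined by its multiset, so distinct lists give distinct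
monomials and nothing cancels modulo `2`. -/
theorem coeff_toMvPolynomial_of_mem (p : F2Poly) {m : List (Fin p.numVars)}
    (hm : m ∈ p.monomials) :
    coeff (Multiset.toFinsupp (m : Multiset (Fin p.numVars))) p.toMvPolynomial = 1 := by
  classical
  have key : ∀ l : List (List (Fin p.numVars)), (∀ m' ∈ l, m'.Pairwise (· < ·)) → l.Nodup →
      coeff (Multiset.toFinsupp (m : Multiset (Fin p.numVars)))
        (l.map fun m => (m.map X).prod : List (MvPolynomial (Fin p.numVars) (ZMod 2))).sum =
      if m ∈ l then 1 else 0 := by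
    intro l
    induction l with
    | nil => simp
    | cons m' l ih =>
      intro hs hn
      rw [List.map_cons, List.sum_cons, coeff_add, ih (fun a ha => hs a (by simp [ha]))
        (List.nodup_cons.1 hn).2, prod_map_X, coeff_monomial]
      have hm' := hs m' (by simp)
      have e : (Multiset.toFinsupp (m' : Multiset (Fin p.numVars)) =
          Multiset.toFinsupp (m : Multiset (Fin p.numVars))) ↔ m = m' := by
        rw [EmbeddingLike.apply_eq_iff_eq, Multiset.coe_eq_coe]
        refine ⟨fun h => ?_, fun h => h ▸ List.Perm.refl _⟩
        exact (h.eq_of_pairwise (fun a b _ _ h₁ h₂ => absurd h₁ h₂.asymm) hm'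
          (p.increasing m hm)).symm
      simp only [e]
      by_cases h : m = m'
      · subst h
        simp [(List.nodup_cons.1 hn).1]
      · simp [h]
  rw [toMvPolynomial, key _ p.increasing p.nodup, if_pos hm]

theorem totalDegree_eq_three (p : F2Poly) (h : ∀ m ∈ p.monomials, m.length ≤ 3)
    {m : List (Fin p.numVars)} (hm : m ∈ p.monomials) (h3 : m.length = 3) :
    p.toMvPolynomial.totalDegree = 3 := by
  refine le_antisymm ?_ ?_
  · have key : ∀ l : List (List (Fin p.numVars)), (∀ m ∈ l, m.length ≤ 3) →
        (l.map fun m => (m.map X).prod :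
          List (MvPolynomial (Fin p.numVars) (ZMod 2))).sum.totalDegree ≤ 3 := by
      intro l
      induction l with
      | nil => simp
      | cons m l ih =>
        intro hl
        rw [List.map_cons, List.sum_cons]
        refine (totalDegree_add _ _).trans (max_le ?_ (ih fun m hm => hl m (by simp [hm])))
        rw [prod_map_X]
        refine (totalDegree_monomial_le _ _).trans ?_
        rw [Multiset.toFinsupp_sum_eq]
        exact hl m (by simp)
    exact key _ h
  · have hc : Multiset.toFinsupp (m : Multiset (Fin p.numVars)) ∈ p.toMvPolynomial.support := by
      rw [mem_support_iff, p.coeff_toMvPolynomial_of_mem hm]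
      exact one_ne_zero
    have := le_totalDegree hc
    exact (h3.symm.trans (Multiset.toFinsupp_sum_eq (m : Multiset (Fin p.numVars))).symm).trans_le
      this

end F2Poly

theorem BoolCircuit.totalDegree_toF2Poly (C : BoolCircuit) :
    C.toF2Poly.toMvPolynomial.totalDegree = 3 := by
  -- The base block supplies a cubic monomial for every circuit, even one without gates.
  refine C.toF2Poly.totalDegree_eq_three (m := [0, 1, 3].map (Fin.ofNat C.polyVars))
    (fun m hm => ?_) ?_ rfl
  · obtain ⟨m', hm', rfl⟩ := List.mem_map.1 hm
    exact (List.length_map _).trans_le (C.length_natMonomials_le m' hm')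
  · exact List.mem_map.2 ⟨[0, 1, 3], by simp [natMonomials, baseMonomials], rfl⟩

/-- The polynomial of a circuit, as a polynomial of degree `3`. -/
def BoolCircuit.toCubic (C : BoolCircuit) : CubicF2Poly := ⟨C.toF2Poly, C.totalDegree_toF2Poly⟩

/-! ### The gap of the polynomial of a circuit -/

/-- The sum of a function over all lists of a given length. -/
def listSum (A : Type) [Fintype A] : ℕ → (List A → ℤ) → ℤ
  | 0, F => F []
  | n + 1, F => ∑ a : A, listSum A n fun l => F (a :: l)

section ListSum

variable {A : Type} [Fintype A]

theorem sum_ofFn_eq_listSum (n : ℕ) (F : List A → ℤ) :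
    ∑ x : Fin n → A, F (List.ofFn x) = listSum A n F := by
  induction n generalizing F with
  | zero => simp [listSum]
  | succ n ih =>
    rw [listSum, ← Fintype.sum_equiv (Fin.consEquiv fun _ => A)
      (fun y => F (y.1 :: List.ofFn y.2)) (fun x => F (List.ofFn x)), Fintype.sum_prod_type]
    · exact Finset.sum_congr rfl fun a _ => ih fun l => F (a :: l)
    · rintro ⟨a, y⟩
      simp [Fin.consEquiv]

theorem listSum_congr {n : ℕ} {F G : List A → ℤ} (h : ∀ l, l.length = n → F l = G l) :
    listSum A n F = listSum A n G := by
  induction n generalizing F G with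
  | zero => exact h [] rfl
  | succ n ih =>
    exact Finset.sum_congr rfl fun a _ => ih fun l hl => h (a :: l) (by simp [hl])

theorem listSum_mul (n : ℕ) (c : ℤ) (F : List A → ℤ) :
    listSum A n (fun l => c * F l) = c * listSum A n F := by
  induction n generalizing F with
  | zero => rfl
  | succ n ih => simp only [listSum, ih, Finset.mul_sum]

theorem listSum_add (m n : ℕ) (F : List A → ℤ) :
    listSum A (m + n) F = listSum A m fun l => listSum A n fun r => F (l ++ r) := by
  induction m generalizing F with
  | zero => simp [listSum]
  | succ m ih =>
    rw [Nat.succ_add]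
    simp only [listSum, ih, List.cons_append]

theorem listSum_four_mul_succ (n : ℕ) (F : List A → ℤ) :
    listSum A (4 * (n + 1)) F = ∑ a : A, ∑ b : A, ∑ c : A, ∑ d : A,
      listSum A (4 * n) fun l => F (a :: b :: c :: d :: l) := rfl

end ListSum

/-! ### Signs, and sums over a single block -/

/-- The sign `(-1)^z`. -/
def zmodSign (z : ZMod 2) : ℤ := (-1) ^ z.val

theorem zmodSign_zero : zmodSign 0 = 1 := rfl

theorem zmodSign_one : zmodSign 1 = -1 := rfl

theorem zmod_two_cases (z : ZMod 2) : z = 0 ∨ z = 1 := by revert z; decide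

theorem zmod_two_one_add_one : (1 : ZMod 2) + 1 = 0 := rfl

theorem zmodSign_add (y z : ZMod 2) : zmodSign (y + z) = zmodSign y * zmodSign z := by
  revert y z; decide

theorem sum_zmod_two (F : ZMod 2 → ℤ) : ∑ z, F z = F 0 + F 1 := Fin.sum_univ_two F

/-- The bit `b` as an element of the field with two elements. -/
def boolZMod (b : Bool) : ZMod 2 := bif b then 1 else 0

theorem listSum_zmodSign (n : ℕ) (f : List Bool → Bool) :
    listSum Bool n (fun x => zmodSign (boolZMod (f x))) =
      listSum Bool n (fun _ => 1) - 2 * listSum Bool n fun x => if f x then 1 else 0 := by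
  induction n generalizing f with
  | zero => cases h : f [] <;> simp [listSum, h, boolZMod, zmodSign_zero, zmodSign_one]
  | succ n ih =>
    simp only [listSum, Fintype.sum_bool, ih fun l => f (_ :: l)]
    ring

/-- Summing over the multipliers `c` and `d` enforces two equations. -/
theorem sum_gate_block (x : ZMod 2) (p : ZMod 2 → ZMod 2) (T : ZMod 2 → ℤ) :
    ∑ a, ∑ b, ∑ c, ∑ d, zmodSign (c * (x + a) + d * (b + p a)) * T b = 4 * T (p x) := by
  simp only [sum_zmod_two]
  rcases zmod_two_cases x with rfl | rfl <;> rcases zmod_two_cases (p 0) with h₀ | h₀ <;>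
  rcases zmod_two_cases (p 1) with h₁ | h₁ <;>
  simp [h₀, h₁, zmodSign_zero, zmodSign_one, zmod_two_one_add_one] <;> ring

/-- The `b`, `d` part is `(s + 1) * b * d`: for `s = 0` the multiplier `d` forces `b = 0`, for `s =
1` it leaves `b` free. The term `a * c` only makes the factor `4` in both cases, since its signs sum
to `2`. -/
theorem sum_input_block (s : ZMod 2) (T : ZMod 2 → ℤ) :
    ∑ a, ∑ b, ∑ c, ∑ d, zmodSign (a * c + (s * (b * d) + b * d)) * T b =
      4 * if s = 1 then T 0 + T 1 else T 0 := by
  simp only [sum_zmod_two]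
  rcases zmod_two_cases s with rfl | rfl <;>
  simp [zmodSign_zero, zmodSign_one, zmod_two_one_add_one] <;> ring

/-! ### Values of the monomials of a block -/

/-- The value of a sum of monomials. -/
def monoVal (l : List (ZMod 2)) (ms : List (List ℕ)) : ZMod 2 :=
  (ms.map fun m => (m.map fun i => l.getD i 0).prod).sum

theorem monoVal_append (l : List (ZMod 2)) (ms ms' : List (List ℕ)) :
    monoVal l (ms ++ ms') = monoVal l ms + monoVal l ms' := by simp [monoVal]

theorem monoVal_append_left (l r : List (ZMod 2)) (ms : List (List ℕ))
    (h : ∀ m ∈ ms, ∀ i ∈ m, i < l.length) : monoVal (l ++ r) ms = monoVal l ms :=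
  congrArg List.sum <| List.map_congr_left fun m hm => congrArg List.prod <|
    List.map_congr_left fun i hi => List.getD_append _ _ _ _ (h m hm i hi)

/-- The list `l` of values of variables contains the list `w` of values of wires. -/
structure EncodesWires (l : List (ZMod 2)) (w : List Bool) : Prop where
  length : l.length = 4 * (w.length + 1)
  val : ∀ i, l.getD (4 * i + 5) 0 = boolZMod (w.getD i false)

/-- Wires beyond the end cause no trouble: both `getD` then return their defaults, and `boolZMod
false = 0`. -/
theorem EncodesWires.snoc {l : List (ZMod 2)} {w : List Bool} (h : EncodesWires l w)
    (a c d : ZMod 2) (b : Bool) : EncodesWires (l ++ [a, boolZMod b, c, d]) (w ++ [b]) := by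
  refine ⟨by simp [h.length]; ring, fun i => ?_⟩
  have hl := h.length
  rcases lt_trichotomy i w.length with hi | hi | hi
  · rw [List.getD_append _ _ _ _ (by omega), List.getD_append _ _ _ _ hi, h.val]
  · subst hi
    rw [List.getD_append_right _ _ _ _ (by omega), List.getD_append_right _ _ _ _ le_rfl,
      show 4 * w.length + 5 - l.length = 1 by omega]
    simp
  · rw [List.getD_append_right _ _ _ _ (by omega), List.getD_append_right _ _ _ _ (by omega),
      List.getD_eq_default _ _ (by simp; omega), List.getD_eq_default _ _ (by simp; omega)]
    rfl

section Blocks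

variable {l : List (ZMod 2)} {w : List Bool} (h : EncodesWires l w) (a b c d : ZMod 2)
  (r : List (ZMod 2))

include h

theorem EncodesWires.getD_block (i : ℕ) :
    (l ++ a :: b :: c :: d :: r).getD (4 * (w.length + 1) + i) 0 =
      (a :: b :: c :: d :: r).getD i 0 := by
  rw [List.getD_append_right _ _ _ _ (by have := h.length; omega), h.length,
    Nat.add_sub_cancel_left]

theorem EncodesWires.getD_wire {i : ℕ} (hi : i < w.length) :
    (l ++ r).getD (4 * i + 5) 0 = boolZMod (w.getD i false) := by
  rw [List.getD_append _ _ _ _ (by have := h.length; omega), h.val]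

/-- This is the shape required by `sum_gate_block`. Here `x` and `p` depend only on earlier wires;
the gate function is recovered only at `a = x`, where the copy is correct. -/
theorem EncodesWires.monoVal_gate {g : BoolGate} (hg : ∀ i ∈ g.inputs, i < w.length) :
    ∃ (x : ZMod 2) (p : ZMod 2 → ZMod 2), p x = boolZMod (g.eval w) ∧ ∀ a b c d r,
      monoVal (l ++ a :: b :: c :: d :: r) (BoolCircuit.gateMonomials (w.length + 1) g) =
        c * (x + a) + d * (b + p a) := by
  have h₀ := fun a b c d r => h.getD_block a b c d r 0
  have h₁ := fun a b c d r => h.getD_block a b c d r 1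
  have h₂ := fun a b c d r => h.getD_block a b c d r 2
  have h₃ := fun a b c d r => h.getD_block a b c d r 3
  rw [add_zero] at h₀
  cases g with
  | and i j =>
    simp only [BoolGate.inputs, List.mem_cons, List.not_mem_nil, or_false, forall_eq_or_imp,
      forall_eq] at hg
    refine ⟨boolZMod (w.getD i false), fun a => boolZMod (w.getD j false) * a, ?_, ?_⟩
    · rw [BoolGate.eval]
      cases w.getD i false <;> cases w.getD j false <;> rfl
    · intro a b c d r
      simp only [monoVal, BoolCircuit.gateMonomials, List.map_cons, List.map_nil, List.prod_cons,
        List.prod_nil, List.sum_cons, List.sum_nil, h₀, h₁, h₂, h₃, h.getD_wire _ hg.1,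
        h.getD_wire _ hg.2, List.getD_cons_zero, List.getD_cons_succ]
      ring
  | or i j =>
    simp only [BoolGate.inputs, List.mem_cons, List.not_mem_nil, or_false, forall_eq_or_imp,
      forall_eq] at hg
    refine ⟨boolZMod (w.getD i false),
      fun a => boolZMod (w.getD j false) * a + a + boolZMod (w.getD j false), ?_, ?_⟩
    · rw [BoolGate.eval]
      cases w.getD i false <;> cases w.getD j false <;> rfl
    · intro a b c d r
      simp only [monoVal, BoolCircuit.gateMonomials, List.map_cons, List.map_nil, List.prod_cons,
        List.prod_nil, List.sum_cons, List.sum_nil, h₀, h₁, h₂, h₃, h.getD_wire _ hg.1,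
        h.getD_wire _ hg.2, List.getD_cons_zero, List.getD_cons_succ]
      ring
  | not i =>
    simp only [BoolGate.inputs, List.mem_cons, List.not_mem_nil, or_false, forall_eq] at hg
    refine ⟨boolZMod (w.getD i false), fun a => a + 1, ?_, ?_⟩
    · rw [BoolGate.eval]
      cases w.getD i false <;> rfl
    · intro a b c d r
      simp only [monoVal, BoolCircuit.gateMonomials, List.map_cons, List.map_nil, List.prod_cons,
        List.prod_nil, List.sum_cons, List.sum_nil, h₀, h₁, h₂, h₃, h.getD_wire _ hg,
        List.getD_cons_zero, List.getD_cons_succ]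
      ring

theorem EncodesWires.monoVal_input :
    monoVal (l ++ a :: b :: c :: d :: r) (BoolCircuit.inputMonomials (w.length + 1)) =
      a * c + (l.getD 0 0 * (b * d) + b * d) := by
  have h₀ := h.getD_block a b c d r 0
  have h₁ := h.getD_block a b c d r 1
  have h₂ := h.getD_block a b c d r 2
  have h₃ := h.getD_block a b c d r 3
  rw [add_zero] at h₀
  have h₄ : (l ++ a :: b :: c :: d :: r).getD 0 0 = l.getD 0 0 :=
    List.getD_append _ _ _ _ (by have := h.length; omega)
  simp only [monoVal, BoolCircuit.inputMonomials, List.map_cons, List.map_nil, List.prod_cons,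
    List.prod_nil, List.sum_cons, List.sum_nil, h₀, h₁, h₂, h₃, h₄, List.getD_cons_zero,
    List.getD_cons_succ]
  ring

end Blocks

theorem exists_boolZMod (z : ZMod 2) : ∃ b, boolZMod b = z := by
  rcases zmod_two_cases z with rfl | rfl
  exacts [⟨false, rfl⟩, ⟨true, rfl⟩]

/-- The sum over the variables of all gates. -/
theorem listSum_gates {l : List (ZMod 2)} {w : List Bool} (h : EncodesWires l w)
    {gs : List BoolGate} (hgs : BoolCircuit.GatesWf w.length gs) (u : ZMod 2) (out : ℕ) :
    listSum (ZMod 2) (4 * gs.length) (fun r =>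
      zmodSign (monoVal (l ++ r) (BoolCircuit.gatesMonomials (w.length + 1) gs) +
        u * (l ++ r).getD (4 * out + 5) 0)) =
      4 ^ gs.length * zmodSign
        (u * boolZMod ((gs.foldl (fun w g => w ++ [g.eval w]) w).getD out false)) := by
  induction gs generalizing l w with
  | nil =>
    simp only [List.length_nil, mul_zero, listSum, BoolCircuit.gatesMonomials, List.append_nil,
      h.val, List.foldl_nil]
    simp [monoVal]
  | cons g gs ih =>
    obtain ⟨x, p, hp, hm⟩ := h.monoVal_gate hgs.head
    -- `T b` is the sum over the later blocks once the new wire has the value `b`; by induction it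
    -- does not depend on `a`, `c`, `d`.
    let T : ZMod 2 → ℤ := fun b => 4 ^ gs.length * zmodSign
      (u * boolZMod ((gs.foldl (fun w g => w ++ [g.eval w]) (w ++ [decide (b = 1)])).getD out
        false))
    have key (a b c d : ZMod 2) : listSum (ZMod 2) (4 * gs.length) (fun r =>
        zmodSign (monoVal (l ++ a :: b :: c :: d :: r)
          (BoolCircuit.gatesMonomials (w.length + 1) (g :: gs)) +
          u * (l ++ a :: b :: c :: d :: r).getD (4 * out + 5) 0)) =
        zmodSign (c * (x + a) + d * (b + p a)) * T b := by
      obtain ⟨b, rfl⟩ := exists_boolZMod b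
      have e : decide (boolZMod b = 1) = b := by cases b <;> rfl
      have := ih (h.snoc a c d b) (by simpa using hgs.tail)
      simp only [List.length_append, List.length_singleton, List.append_assoc, List.cons_append,
        List.nil_append] at this
      simp only [T, e]
      rw [← this, ← listSum_mul]
      refine listSum_congr fun r _ => ?_
      rw [BoolCircuit.gatesMonomials, monoVal_append, hm, ← zmodSign_add]
      congr 1
      ring
    rw [List.length_cons, listSum_four_mul_succ]
    simp only [key, sum_gate_block, hp, T]
    have e : decide (boolZMod (g.eval w) = 1) = g.eval w := by cases g.eval w <;> rfl
    rw [e, List.foldl_cons]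
    ring

/-- The sum over the variables of all inputs. -/
theorem listSum_inputs {l : List (ZMod 2)} {w : List Bool} (h : EncodesWires l w) (n : ℕ)
    (Φ : List (ZMod 2) → ℤ) (T : List Bool → ℤ)
    (hΦ : ∀ r w', EncodesWires (l ++ r) w' → w'.length = w.length + n → Φ (l ++ r) = T w') :
    listSum (ZMod 2) (4 * n) (fun r =>
      zmodSign (monoVal (l ++ r) (BoolCircuit.inputsMonomials (w.length + 1) n)) * Φ (l ++ r)) =
      4 ^ n * if l.getD 0 0 = 1 then listSum Bool n (fun x => T (w ++ x))
        else T (w ++ List.replicate n false) := by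
  induction n generalizing l w with
  | zero =>
    have := hΦ [] w (by simpa using h) (by simp)
    simp only [List.append_nil] at this
    simp [listSum, BoolCircuit.inputsMonomials, monoVal, zmodSign_zero, this]
  | succ n ih =>
    -- The sum over the later blocks when the current input bit is `b`. Variable `0` is the switch
    -- `s`, and it stays the same throughout the induction.
    let T' : ZMod 2 → ℤ := fun b => 4 ^ n * if l.getD 0 0 = 1
      then listSum Bool n (fun x => T (w ++ decide (b = 1) :: x))
      else T (w ++ decide (b = 1) :: List.replicate n false)
    have key (a b c d : ZMod 2) : listSum (ZMod 2) (4 * n) (fun r =>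
        zmodSign (monoVal (l ++ a :: b :: c :: d :: r)
          (BoolCircuit.inputsMonomials (w.length + 1) (n + 1))) *
          Φ (l ++ a :: b :: c :: d :: r)) =
        zmodSign (a * c + (l.getD 0 0 * (b * d) + b * d)) * T' b := by
      obtain ⟨b, rfl⟩ := exists_boolZMod b
      have e : decide (boolZMod b = 1) = b := by cases b <;> rfl
      have e₀ : (l ++ [a, boolZMod b, c, d]).getD 0 0 = l.getD 0 0 :=
        List.getD_append _ _ _ _ (by have := h.length; omega)
      have := ih (h.snoc a c d b) (fun r w' hr hw' => by
        rw [List.append_assoc] at hr ⊢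
        exact hΦ _ _ hr (by simp at hw'; omega))
      simp only [List.length_append, List.length_singleton, List.append_assoc, List.cons_append,
        List.nil_append] at this e₀
      rw [e₀] at this
      simp only [T', e]
      rw [← this, ← listSum_mul]
      refine listSum_congr fun r _ => ?_
      rw [BoolCircuit.inputsMonomials, monoVal_append, h.monoVal_input, zmodSign_add]
      ring
    rw [listSum_four_mul_succ]
    simp only [key, sum_input_block, T', pow_succ, listSum]
    by_cases hs : l.getD 0 0 = 1
    · simp only [hs, if_true, Fintype.sum_bool]
      simp
      ring
    · simp only [hs, if_false]
      simp [List.replicate_succ]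
      ring

theorem F2Poly.eval_toMvPolynomial (p : F2Poly) (x : Fin p.numVars → ZMod 2) :
    MvPolynomial.eval x p.toMvPolynomial = (p.monomials.map fun m => (m.map x).prod).sum := by
  rw [toMvPolynomial, map_list_sum, List.map_map]
  refine congrArg List.sum (List.map_congr_left fun m _ => ?_)
  rw [Function.comp_apply, map_list_prod, List.map_map]
  exact congrArg List.prod (List.map_congr_left fun i _ => MvPolynomial.eval_X i)

namespace BoolCircuit

theorem count_eq_listSum (C : BoolCircuit) : (C.count : ℤ) = listSum Bool C.numInputs fun x =>
    if (C.gates.foldl (fun w g => w ++ [g.eval w]) x).getD C.out false then 1 else 0 := by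
  rw [← sum_ofFn_eq_listSum, count]
  simp [eval, wireValues]

theorem eval_toF2Poly (C : BoolCircuit) (x : Fin C.polyVars → ZMod 2) :
    MvPolynomial.eval x C.toF2Poly.toMvPolynomial = monoVal (List.ofFn x) C.natMonomials := by
  refine (C.toF2Poly.eval_toMvPolynomial x).trans ?_
  change ((C.natMonomials.map fun m => m.map (Fin.ofNat C.polyVars)).map
    fun m => (m.map x).prod).sum = _
  rw [List.map_map]
  refine congrArg List.sum (List.map_congr_left fun m hm => ?_)
  rw [Function.comp_apply, List.map_map]
  refine congrArg List.prod (List.map_congr_left fun i hi => ?_)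
  have hi' := C.lt_polyVars m hm i hi
  rw [List.getD_eq_getElem _ _ (by simpa using hi'), List.getElem_ofFn]
  exact congrArg x (Fin.ext (Nat.mod_eq_of_lt hi'))

/-- The gap of the polynomial of a circuit determines the count of the circuit. -/
theorem gap_toCubic (C : BoolCircuit) :
    C.toCubic.gap = 4 ^ (C.numInputs + C.gates.length + 1) * (2 * C.count + 1) := by
  have e : C.toCubic.gap = listSum (ZMod 2) C.polyVars fun l =>
      zmodSign (monoVal l C.natMonomials) := by
    rw [← sum_ofFn_eq_listSum]
    exact Finset.sum_congr rfl fun x _ => congrArg zmodSign (C.eval_toF2Poly x)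
  -- With block `0` fixed, the sum over the gates becomes the function `Φ` that is summed over the
  -- inputs; the output monomial enters it with `u = s * y`.
  have main (s t y z : ZMod 2) : (listSum (ZMod 2) (4 * C.numInputs) fun r₁ =>
      listSum (ZMod 2) (4 * C.gates.length) fun r₂ =>
        zmodSign (monoVal (s :: t :: y :: z :: (r₁ ++ r₂)) C.natMonomials)) =
      zmodSign (s * y + (s * t * z + t * z)) * (4 ^ C.numInputs * if s = 1 then
        listSum Bool C.numInputs (fun x => 4 ^ C.gates.length * zmodSign (s * y *
          boolZMod ((C.gates.foldl (fun w g => w ++ [g.eval w]) x).getD C.out false)))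
        else 4 ^ C.gates.length * zmodSign (s * y * boolZMod ((C.gates.foldl
          (fun w g => w ++ [g.eval w]) (List.replicate C.numInputs false)).getD C.out
            false))) := by
    have h₀ : EncodesWires [s, t, y, z] [] := ⟨rfl, fun i => by simp [boolZMod]⟩
    have := listSum_inputs h₀ C.numInputs (fun l => listSum (ZMod 2) (4 * C.gates.length)
      fun r => zmodSign (monoVal (l ++ r) (gatesMonomials (C.numInputs + 1) C.gates) +
        s * y * (l ++ r).getD (4 * C.out + 5) 0)) (fun w => 4 ^ C.gates.length * zmodSign
        (s * y * boolZMod ((C.gates.foldl (fun w g => w ++ [g.eval w]) w).getD C.out false)))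
      (fun r w hr hw => by
        have hw' : w.length = C.numInputs := by simpa using hw
        have := listSum_gates hr (gs := C.gates) (by rw [hw']; exact C.gates_wf) (s * y) C.out
        rw [hw'] at this
        exact this)
    simp only [List.nil_append, List.cons_append, List.getD_cons_zero, List.length_nil,
      Nat.zero_add] at this
    rw [← this, ← listSum_mul]
    refine listSum_congr fun r₁ hr₁ => ?_
    rw [← mul_assoc, ← zmodSign_add, ← listSum_mul]
    refine listSum_congr fun r₂ _ => ?_
    rw [← zmodSign_add]
    congr 1
    -- Input monomials involve only block `0` and the input blocks, so their sign factors out of the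
    -- sum over the gate variables.
    have hi : monoVal (s :: t :: y :: z :: (r₁ ++ r₂)) (inputsMonomials 1 C.numInputs) =
        monoVal (s :: t :: y :: z :: r₁) (inputsMonomials 1 C.numInputs) :=
      monoVal_append_left (s :: t :: y :: z :: r₁) r₂ _ fun m hm i hi => by
        have := (isBlockMonomial_inputs 1 _ m hm).2.2.1 i hi
        simp
        omega
    rw [natMonomials, monoVal_append, monoVal_append, monoVal_append, hi]
    simp only [monoVal, baseMonomials, List.map_cons, List.map_nil, List.prod_cons, List.prod_nil,
      List.sum_cons, List.sum_nil, List.getD_cons_zero, List.getD_cons_succ]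
    ring
  rw [e, polyVars, show 4 * (C.numInputs + C.gates.length + 1) =
    4 * (0 + 1) + (4 * C.numInputs + 4 * C.gates.length) by ring, listSum_add]
  simp only [listSum_add, listSum, List.cons_append, List.nil_append]
  simp only [main, sum_zmod_two, count_eq_listSum]
  -- For `s = 1` the terms `y = 0` and `y = 1` have opposite signs, and `listSum_zmodSign` leaves `2
  -- * count` after the full sums cancel; `t` and `z` give `4`. For `s = 0`, `t` and `z` give `2`
  -- and `y` gives `2`.
  simp only [zero_ne_one, if_true, if_false, zero_mul, mul_zero, one_mul, mul_one, add_zero,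
    zero_add,
    zmod_two_one_add_one, zmodSign_zero, zmodSign_one, listSum_mul, listSum_zmodSign]
  -- In the term `y = 0` the summand has been simplified to the constant `4 ^ C.gates.length`; this
  -- restores the factor so that the full sums can cancel.
  have hc := listSum_mul C.numInputs (4 ^ C.gates.length) fun _ : List Bool => 1
  simp only [mul_one] at hc
  rw [hc]
  ring

end BoolCircuit

/-! ### The program that writes the polynomial of a circuit -/

namespace Turing.Prog

section Basic

variable {A B C R : Type} [DecidableEq C]

theorem Exec.cast {p : Prog A B C R} {s s' : PState A B C R} {t t' : ℕ} (h : Exec p s s' t)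
    (e : t = t') : Exec p s s' t' := e ▸ h

/-- The program that does nothing. -/
def skip : Prog A B C R := .load fun r => r

theorem Exec.skip (s : PState A B C R) : Exec skip s s 1 := .load _ s

/-- Repeat a program a fixed number of times. -/
def rep (p : Prog A B C R) : ℕ → Prog A B C R
  | 0 => skip
  | n + 1 => .seq p (rep p n)

theorem Exec.rep_write (b : B) (n : ℕ) (r : R) (inp : List A) (out : List B) (ctr : C → ℕ) :
    Exec (rep (.write fun _ => b) n) ⟨r, inp, out, ctr⟩
      ⟨r, inp, List.replicate n b ++ out, ctr⟩ (n + 1) := by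
  induction n generalizing out with
  | zero => exact .skip _
  | succ n ih =>
    have e : List.replicate (n + 1) b ++ out = List.replicate n b ++ b :: out := by
      rw [List.replicate_succ', List.append_assoc]
      rfl
    rw [e]
    exact (Exec.seq (.write _ _) (ih (b :: out))).cast (by omega)

/-- Set a counter to zero. -/
def clear (c : C) : Prog A B C R := .whileCtr c skip

theorem Exec.clear (c : C) (r : R) (inp : List A) (out : List B) (ctr : C → ℕ) :
    Exec (clear c) ⟨r, inp, out, ctr⟩ ⟨r, inp, out, Function.update ctr c 0⟩
      (2 * ctr c + 1) := by
  generalize hn : ctr c = n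
  induction n generalizing ctr with
  | zero =>
    rw [Function.update_eq_self_iff.2 hn.symm]
    exact .whileCtr_done hn
  | succ n ih =>
    have := ih (Function.update ctr c n) (by simp)
    rw [Function.update_idem] at this
    exact Exec.cast (Exec.whileCtr_step hn (.skip _) this) (by omega)

/-- For each unit of the counter `c`, increment `d` and write `m` times the symbol `b`. -/
theorem Exec.whileCtr_inc_write {c d : C} (hcd : d ≠ c) (b : B) (m : ℕ) (r : R) (inp : List A)
    (out : List B) (ctr : C → ℕ) :
    Exec (.whileCtr c (.seq (.inc d) (rep (.write fun _ => b) m))) ⟨r, inp, out, ctr⟩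
      ⟨r, inp, List.replicate (m * ctr c) b ++ out,
        Function.update (Function.update ctr c 0) d (ctr d + ctr c)⟩
      ((m + 3) * ctr c + 1) := by
  generalize hn : ctr c = n
  induction n generalizing ctr out with
  | zero =>
    have e : Function.update (Function.update ctr c 0) d (ctr d + 0) = ctr := by
      rw [Function.update_eq_self_iff (a := c) |>.2 hn.symm, add_zero, Function.update_eq_self]
    rw [e]
    exact .whileCtr_done hn
  | succ n ih =>
    have := ih (List.replicate m b ++ out)
      (Function.update (Function.update ctr c n) d (ctr d + 1)) (by simp [hcd.symm])
    have e : Function.update (Function.update (Function.update (Function.update ctr c n) d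
        (ctr d + 1)) c 0) d (Function.update (Function.update ctr c n) d (ctr d + 1) d + n) =
        Function.update (Function.update ctr c 0) d (ctr d + (n + 1)) := by
      funext x
      by_cases hd : x = d
      · subst hd
        simp
        omega
      · by_cases hc : x = c
        · subst hc
          simp [hd]
        · simp [hd, hc]
    rw [e, ← List.append_assoc, List.replicate_append_replicate, ← Nat.mul_succ] at this
    refine (Exec.whileCtr_step hn (Exec.seq (.inc d _) (.rep_write b m _ _ _ _)) ?_).cast
      (t := 1 + (m + 1) + ((m + 3) * n + 1) + 1) (by ring)
    simpa [hcd] using this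

/-- For each unit of the counter `c`, write `m` times the symbol `b`. -/
theorem Exec.whileCtr_write (c : C) (b : B) (m : ℕ) (r : R) (inp : List A) (out : List B)
    (ctr : C → ℕ) :
    Exec (.whileCtr c (rep (.write fun _ => b) m)) ⟨r, inp, out, ctr⟩
      ⟨r, inp, List.replicate (m * ctr c) b ++ out, Function.update ctr c 0⟩
      ((m + 2) * ctr c + 1) := by
  generalize hn : ctr c = n
  induction n generalizing ctr out with
  | zero =>
    rw [Function.update_eq_self_iff.2 hn.symm]
    exact .whileCtr_done hn
  | succ n ih =>
    have := ih (List.replicate m b ++ out) (Function.update ctr c n) (by simp)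
    rw [Function.update_idem, ← List.append_assoc, List.replicate_append_replicate,
      ← Nat.mul_succ] at this
    exact (Exec.whileCtr_step hn (.rep_write b m _ _ _ _) this).cast (by ring)

/-- Count the occurrences of the symbol `a` at the beginning of the input. -/
def countSym [DecidableEq A] (a : A) (c : C) : Prog A B C R :=
  .whileInp (fun o => decide (o = some a)) (.seq (.read fun r _ => r) (.inc c))

theorem Exec.countSym [DecidableEq A] (a : A) (c : C) (n : ℕ) {inp : List A}
    (h : inp.head? ≠ some a) (r : R) (out : List B) (ctr : C → ℕ) :
    Exec (countSym a c) ⟨r, List.replicate n a ++ inp, out, ctr⟩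
      ⟨r, inp, out, Function.update ctr c (ctr c + n)⟩ (3 * n + 1) := by
  induction n generalizing ctr with
  | zero =>
    rw [add_zero, Function.update_eq_self]
    exact .whileInp_done (by simpa using h)
  | succ n ih =>
    have := ih (Function.update ctr c (ctr c + 1))
    rw [Function.update_idem, Function.update_self, add_assoc, add_comm 1 n] at this
    exact Exec.cast (Exec.whileInp_step (by simp [List.replicate_succ])
      (.seq (.read _ _) (.inc c _)) this) (by ring)

/-- Skip the first symbols of the input, as long as they satisfy `b`. -/
def skipWhile (b : A → Bool) : Prog A B C R :=
  .whileInp (fun o => o.any b) (.read fun r _ => r)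

theorem Exec.skipWhile (b : A → Bool) {x : List A} (hx : ∀ a ∈ x, b a = true) {inp : List A}
    (h : inp.head?.any b = false) (r : R) (out : List B) (ctr : C → ℕ) :
    Exec (skipWhile b) ⟨r, x ++ inp, out, ctr⟩ ⟨r, inp, out, ctr⟩ (2 * x.length + 1) := by
  induction x with
  | nil => exact .whileInp_done h
  | cons a x ih =>
    exact Exec.cast (Exec.whileInp_step (by simpa using hx a (by simp)) (.read _ _)
      (ih fun a ha => hx a (by simp [ha]))) (by simp; ring)

end Basic

/-! #### Printing monomials -/

/-- The counters of the program: the number of the current block, the inputs of the current gate,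
and a temporary counter. -/
inductive Ctr where
  | block
  | fst
  | snd
  | tmp
  deriving DecidableEq

instance : Fintype Ctr := ⟨{.block, .fst, .snd, .tmp}, fun x => by cases x <;> simp⟩

/-- A variable whose number is computed from the value of a counter: `(c, r)` is the variable with
the number `4 * c + r`. -/
abbrev SymVar := Ctr × ℕ

/-- The number of a variable. -/
def SymVar.value (ctr : Ctr → ℕ) (v : SymVar) : ℕ := 4 * ctr v.1 + v.2

/-- The encoding of a list of variables. -/
def encodeVars (m : List ℕ) : List PolySymbol :=
  m.flatMap fun i => .comma :: List.replicate i .tick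

/-- The encoding of a list of monomials. -/
def encodeMonomials (ms : List (List ℕ)) : List PolySymbol :=
  ms.flatMap fun m => .plus :: encodeVars m

/-- The programs that are used to write the polynomial of a circuit. -/
abbrev PolyProg := Prog CircuitSymbol PolySymbol Ctr (Option CircuitSymbol)

/-- Write a variable. -/
def printVar (v : SymVar) : PolyProg :=
  .seq (rep (.write fun _ => .tick) v.2) <|
  .seq (.whileCtr v.1 (.seq (.inc .tmp) (rep (.write fun _ => .tick) 4))) <|
  .seq (.whileCtr .tmp (.seq (.inc v.1) (rep (.write fun _ => .tick) 0))) <|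
  .write fun _ => .comma

/-- Write a list of variables. -/
def printVars : List SymVar → PolyProg
  | [] => skip
  | v :: vs => .seq (printVars vs) (printVar v)

/-- Write a list of monomials. -/
def printMonomials : List (List SymVar) → PolyProg
  | [] => skip
  | m :: ms => .seq (printMonomials ms) (.seq (printVars m) (.write fun _ => .plus))

variable (r : Option CircuitSymbol) (inp : List CircuitSymbol) (out : List PolySymbol)
  {ctr : Ctr → ℕ}

/-- Reading a counter empties it, so its units are moved to `.tmp`, with four ticks written for
each, and then moved back. The output grows at its front, so the comma is written last. -/
theorem Exec.printVar {v : SymVar} (hv : v.1 ≠ .tmp) (hctr : ctr .tmp = 0) :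
    Exec (printVar v) ⟨r, inp, out, ctr⟩
      ⟨r, inp, encodeVars [v.value ctr] ++ out, ctr⟩ (10 * ctr v.1 + v.2 + 4) := by
  obtain ⟨c, k⟩ := v
  dsimp only at hv
  have h₁ := Exec.rep_write (A := CircuitSymbol) PolySymbol.tick k r inp out ctr
  have h₂ := Exec.whileCtr_inc_write (A := CircuitSymbol) hv.symm PolySymbol.tick 4 r inp
    (List.replicate k .tick ++ out) ctr
  have h₃ := Exec.whileCtr_inc_write (A := CircuitSymbol) hv PolySymbol.tick 0 r inp
    (List.replicate (4 * ctr c) .tick ++ (List.replicate k .tick ++ out))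
    (Function.update (Function.update ctr c 0) .tmp (ctr .tmp + ctr c))
  have e : Function.update (Function.update (Function.update (Function.update ctr c 0) .tmp
      (ctr .tmp + ctr c)) .tmp 0) c (Function.update (Function.update ctr c 0) .tmp
      (ctr .tmp + ctr c) c + Function.update (Function.update ctr c 0) .tmp
      (ctr .tmp + ctr c) .tmp) = ctr := by
    funext x
    by_cases hx : x = c
    · subst hx
      simp [hv, hctr]
    · by_cases hx' : x = .tmp
      · subst hx'
        simp [hctr, hx]
      · simp [hx, hx']
  rw [e] at h₃
  have e' : encodeVars [SymVar.value ctr (c, k)] ++ out = PolySymbol.comma ::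
      (List.replicate (0 * Function.update (Function.update ctr c 0) .tmp (ctr .tmp + ctr c) .tmp)
        .tick ++ (List.replicate (4 * ctr c) .tick ++ (List.replicate k .tick ++ out))) := by
    simp [encodeVars, SymVar.value]
    rw [List.replicate_add, List.append_assoc]
  rw [e']
  refine Exec.cast (.seq h₁ (.seq h₂ (.seq h₃ (.write _ _)))) ?_
  simp [hctr]
  ring

theorem Exec.printVars {vs : List SymVar} (hvs : ∀ v ∈ vs, v.1 ≠ .tmp) :
    ∃ K, ∀ (out : List PolySymbol) (r inp) (ctr : Ctr → ℕ) (N : ℕ), ctr .tmp = 0 →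
      (∀ c, ctr c ≤ N) → ∃ t ≤ K * (N + 1), Exec (printVars vs) ⟨r, inp, out, ctr⟩
        ⟨r, inp, encodeVars (vs.map (SymVar.value ctr)) ++ out, ctr⟩ t := by
  induction vs with
  | nil => exact ⟨1, fun out r inp ctr N _ _ => ⟨1, by omega, .skip _⟩⟩
  | cons v vs ih =>
    obtain ⟨K, hK⟩ := ih fun v hv => hvs v (by simp [hv])
    refine ⟨K + (10 + (v.2 + 4)), fun out r inp ctr N hctr hN => ?_⟩
    obtain ⟨t, ht, h⟩ := hK out r inp ctr N hctr hN
    refine ⟨t + (10 * ctr v.1 + v.2 + 4), ?_, Exec.seq h ?_⟩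
    rotate_left
    · have := Exec.printVar r inp (encodeVars (vs.map (SymVar.value ctr)) ++ out)
        (hvs v (by simp)) hctr
      simpa [encodeVars] using this
    · have := hN v.1
      rw [add_mul, add_mul]
      have : (v.2 + 4) * 1 ≤ (v.2 + 4) * (N + 1) := Nat.mul_le_mul_left _ (by omega)
      omega

/-- The constant `K` depends only on the symbolic monomials, which are fixed in the program, so
printing takes time linear in the largest counter. -/
theorem Exec.printMonomials {ms : List (List SymVar)} (hms : ∀ m ∈ ms, ∀ v ∈ m, v.1 ≠ .tmp) :
    ∃ K, ∀ (out : List PolySymbol) (r inp) (ctr : Ctr → ℕ) (N : ℕ), ctr .tmp = 0 →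
      (∀ c, ctr c ≤ N) → ∃ t ≤ K * (N + 1), Exec (printMonomials ms) ⟨r, inp, out, ctr⟩
        ⟨r, inp, encodeMonomials (ms.map fun m => m.map (SymVar.value ctr)) ++ out, ctr⟩ t := by
  induction ms with
  | nil => exact ⟨1, fun out r inp ctr N _ _ => ⟨1, by omega, .skip _⟩⟩
  | cons m ms ih =>
    obtain ⟨K, hK⟩ := ih fun m hm => hms m (by simp [hm])
    obtain ⟨K', hK'⟩ := Exec.printVars (hms m (by simp))
    refine ⟨K + (K' + 1), fun out r inp ctr N hctr hN => ?_⟩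
    obtain ⟨t, ht, h⟩ := hK out r inp ctr N hctr hN
    obtain ⟨t', ht', h'⟩ := hK' (encodeMonomials (ms.map fun m => m.map (SymVar.value ctr)) ++ out)
      r inp ctr N hctr hN
    refine ⟨t + (t' + 1), ?_, ?_⟩
    · rw [add_mul, add_mul]
      omega
    · have := Exec.seq h (Exec.seq h' (.write (fun _ => .plus) _))
      simpa [encodeMonomials, Prog.printMonomials] using this

/-! #### The program for circuits -/

/-- The values of the counters when the temporary counter is zero. -/
def ctrs (k i j : ℕ) : Ctr → ℕ
  | .block => k
  | .fst => i
  | .snd => j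
  | .tmp => 0

theorem update_ctrs_block (k i j x : ℕ) :
    Function.update (ctrs k i j) .block x = ctrs x i j := by
  funext c; cases c <;> rfl

theorem update_ctrs_fst (k i j x : ℕ) : Function.update (ctrs k i j) .fst x = ctrs k x j := by
  funext c; cases c <;> rfl

theorem update_ctrs_snd (k i j x : ℕ) : Function.update (ctrs k i j) .snd x = ctrs k i x := by
  funext c; cases c <;> rfl

/-- The monomials that are common to all gates. -/
def symGate : List (List SymVar) :=
  [[(.fst, 5), (.block, 2)], [(.block, 0), (.block, 2)], [(.block, 1), (.block, 3)]]

/-- The monomials for an AND gate. -/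
def symAnd : List (List SymVar) := symGate ++ [[(.snd, 5), (.block, 0), (.block, 3)]]

/-- The monomials for an OR gate. -/
def symOr : List (List SymVar) := symAnd ++ [[(.block, 0), (.block, 3)], [(.snd, 5), (.block, 3)]]

/-- The monomials for a NOT gate. -/
def symNot : List (List SymVar) := symGate ++ [[(.block, 0), (.block, 3)], [(.block, 3)]]

/-- The monomials for an input. -/
def symInput : List (List SymVar) :=
  [[(.block, 0), (.block, 2)], [(.fst, 0), (.block, 1), (.block, 3)], [(.block, 1), (.block, 3)]]

/-- The monomial for the output. -/
def symOut : List (List SymVar) := [[(.snd, 0), (.snd, 2), (.fst, 5)]]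

/-- The monomials that are independent of the circuit. -/
def symBase : List (List SymVar) :=
  [[(.block, 0), (.block, 2)], [(.block, 0), (.block, 1), (.block, 3)], [(.block, 1), (.block, 3)]]

/-- Read a gate and write its monomials. -/
def gateProg : PolyProg :=
  .seq (.read fun _ o => o) <|
  .seq (countSym .tick .fst) <|
  .seq (.ite (fun r => decide (r = some .not)) skip
    (.seq (.read fun r _ => r) (countSym .tick .snd))) <|
  .seq (.ite (fun r => decide (r = some .and)) (printMonomials symAnd)
    (.ite (fun r => decide (r = some .or)) (printMonomials symOr) (printMonomials symNot))) <|
  .seq (clear .fst) <| .seq (clear .snd) (.inc .block)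

/-- Read the inputs and write their monomials. -/
def inputsProg : PolyProg :=
  .whileInp (fun o => decide (o = some .tick)) <|
    .seq (.read fun r _ => r) <| .seq (printMonomials symInput) (.inc .block)

/-- Read a circuit and write its polynomial. -/
def circuitProg : PolyProg :=
  .seq (printMonomials symBase) <| .seq (.inc .block) <| .seq inputsProg <|
  .seq (.read fun r _ => r) <| .seq (countSym .tick .fst) <| .seq (printMonomials symOut) <|
  .seq (clear .fst) <| .seq (.whileInp Option.isSome gateProg) <|
  .seq (.whileCtr .block (rep (.write fun _ => .tick) 4)) (.load fun _ => none)

theorem encodeMonomials_append (ms ms' : List (List ℕ)) :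
    encodeMonomials (ms ++ ms') = encodeMonomials ms ++ encodeMonomials ms' :=
  List.flatMap_append

/-- The symbol for the type of a gate. -/
def gateSymbol : BoolGate → CircuitSymbol
  | .and _ _ => .and
  | .or _ _ => .or
  | .not _ => .not

/-- The last wire number of a gate has no end marker of its own, hence the condition that no tick
follows. The register keeps the gate symbol and thereby selects the monomials to print. -/
theorem Exec.gateProg : ∃ K, ∀ (g : BoolGate) (k : ℕ) (r inp out) (N : ℕ),
    inp.head? ≠ some CircuitSymbol.tick → k ≤ N → (∀ i ∈ g.inputs, i ≤ N) →
    ∃ t ≤ K * (N + 1), Exec gateProg ⟨r, g.encode ++ inp, out, ctrs k 0 0⟩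
      ⟨some (gateSymbol g), inp, encodeMonomials (BoolCircuit.gateMonomials k g) ++ out,
        ctrs (k + 1) 0 0⟩ t := by
  obtain ⟨Ka, ha⟩ := Exec.printMonomials (ms := symAnd) (by decide)
  obtain ⟨Ko, ho⟩ := Exec.printMonomials (ms := symOr) (by decide)
  obtain ⟨Kn, hn⟩ := Exec.printMonomials (ms := symNot) (by decide)
  refine ⟨Ka + Ko + Kn + 100, fun g k r inp out N hinp hk hg => ?_⟩
  have hle {i j : ℕ} (hi : i ≤ N) (hj : j ≤ N) : ∀ c, ctrs k i j c ≤ N := by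
    intro c; cases c <;> simp [ctrs, hk, hi, hj]
  have hclear (s : Option CircuitSymbol) (out : List PolySymbol) (i j : ℕ) :
      Exec (.seq (Prog.clear .fst) (.seq (Prog.clear .snd) (.inc .block)))
        ⟨s, inp, out, ctrs k i j⟩ ⟨s, inp, out, ctrs (k + 1) 0 0⟩
        (2 * i + 1 + (2 * j + 1 + 1)) := by
    have h₁ := Exec.clear .fst s inp out (ctrs k i j)
    rw [update_ctrs_fst] at h₁
    have h₂ := Exec.clear .snd s inp out (ctrs k 0 j)
    rw [update_ctrs_snd] at h₂
    have h₃ := Exec.inc .block (⟨s, inp, out, ctrs k 0 0⟩ : PState CircuitSymbol _ _ _)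
    rw [update_ctrs_block] at h₃
    exact .seq h₁ (.seq h₂ h₃)
  have hfst (s : Option CircuitSymbol) (i : ℕ) {inp' : List CircuitSymbol}
      (h : inp'.head? ≠ some .tick) :
      Exec (Prog.countSym CircuitSymbol.tick .fst)
        ⟨s, List.replicate i .tick ++ inp', out, ctrs k 0 0⟩
        ⟨s, inp', out, ctrs k i 0⟩ (3 * i + 1) := by
    have := Exec.countSym CircuitSymbol.tick .fst i h s out (ctrs k 0 0)
    rwa [update_ctrs_fst, show ctrs k 0 0 .fst + i = i from Nat.zero_add i] at this
  have hsnd (s : Option CircuitSymbol) (i j : ℕ) :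
      Exec (Prog.countSym CircuitSymbol.tick .snd)
        ⟨s, List.replicate j .tick ++ inp, out, ctrs k i 0⟩
        ⟨s, inp, out, ctrs k i j⟩ (3 * j + 1) := by
    have := Exec.countSym CircuitSymbol.tick .snd j hinp s out (ctrs k i 0)
    rwa [update_ctrs_snd, show ctrs k i 0 .snd + j = j from Nat.zero_add j] at this
  unfold Prog.gateProg
  cases g with
  | and i j =>
    simp only [BoolGate.inputs, List.mem_cons, List.not_mem_nil, or_false, forall_eq_or_imp,
      forall_eq] at hg
    have h₁ := hfst (some .and) i (inp' := .comma :: (List.replicate j .tick ++ inp)) (by simp)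
    have e : (BoolGate.and i j).encode ++ inp = .and :: (List.replicate i .tick ++ .comma ::
        (List.replicate j .tick ++ inp)) := by simp [BoolGate.encode]
    rw [e]
    obtain ⟨t, ht, h⟩ := ha out (some .and) inp (ctrs k i j) N rfl (hle hg.1 hg.2)
    refine ⟨_, ?_, .seq (.read _ _) (.seq h₁ (.seq (.ite_false rfl (.seq (.read _ _) (hsnd _ i j)))
      (.seq (.ite_true rfl h) (hclear _ _ i j))))⟩
    rw [add_mul, add_mul, add_mul]
    omega
  | or i j =>
    simp only [BoolGate.inputs, List.mem_cons, List.not_mem_nil, or_false, forall_eq_or_imp,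
      forall_eq] at hg
    have h₁ := hfst (some .or) i (inp' := .comma :: (List.replicate j .tick ++ inp)) (by simp)
    have e : (BoolGate.or i j).encode ++ inp = .or :: (List.replicate i .tick ++ .comma ::
        (List.replicate j .tick ++ inp)) := by simp [BoolGate.encode]
    rw [e]
    obtain ⟨t, ht, h⟩ := ho out (some .or) inp (ctrs k i j) N rfl (hle hg.1 hg.2)
    refine ⟨_, ?_, .seq (.read _ _) (.seq h₁ (.seq (.ite_false rfl (.seq (.read _ _) (hsnd _ i j)))
      (.seq (.ite_false rfl (.ite_true rfl h)) (hclear _ _ i j))))⟩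
    rw [add_mul, add_mul, add_mul]
    omega
  | not i =>
    simp only [BoolGate.inputs, List.mem_cons, List.not_mem_nil, or_false, forall_eq] at hg
    have h₁ := hfst (some .not) i hinp
    obtain ⟨t, ht, h⟩ := hn out (some .not) inp (ctrs k i 0) N rfl (hle hg (Nat.zero_le _))
    refine ⟨_, ?_, .seq (.read _ _) (.seq h₁ (.seq (.ite_true rfl (.skip _))
      (.seq (.ite_false rfl (.ite_false rfl h)) (hclear _ _ i 0))))⟩
    rw [add_mul, add_mul, add_mul]
    omega

theorem head?_encode_gates (gs : List BoolGate) :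
    (gs.flatMap BoolGate.encode).head? ≠ some .tick := by
  rcases gs with _ | ⟨g, gs⟩
  · simp
  · cases g <;> simp [BoolGate.encode]

theorem Exec.gatesProg : ∃ K, ∀ (gs : List BoolGate) (k : ℕ) (r out) (N : ℕ),
    k + gs.length ≤ N → (∀ g ∈ gs, ∀ i ∈ g.inputs, i ≤ N) →
    ∃ r' t, t ≤ K * (N + 1) * gs.length + 1 ∧ Exec (.whileInp Option.isSome Prog.gateProg)
      ⟨r, gs.flatMap BoolGate.encode, out, ctrs k 0 0⟩
      ⟨r', [], encodeMonomials (BoolCircuit.gatesMonomials k gs) ++ out,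
        ctrs (k + gs.length) 0 0⟩ t := by
  obtain ⟨K, hK⟩ := Exec.gateProg
  refine ⟨K + 1, fun gs => ?_⟩
  induction gs with
  | nil => exact fun k r out N _ _ => ⟨r, 1, by omega, .whileInp_done rfl⟩
  | cons g gs ih =>
    intro k r out N hk hg
    rw [List.length_cons] at hk
    obtain ⟨t₁, ht₁, h₁⟩ := hK g k r (gs.flatMap BoolGate.encode) out N (head?_encode_gates gs)
      (by omega) (hg g (by simp))
    obtain ⟨r', t₂, ht₂, h₂⟩ := ih (k + 1) (some (gateSymbol g))
      (encodeMonomials (BoolCircuit.gateMonomials k g) ++ out) N (by omega)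
      fun g hg' => hg g (by simp [hg'])
    refine ⟨r', t₁ + t₂ + 1, ?_, ?_⟩
    · rw [List.length_cons, Nat.mul_succ]
      have : (K + 1) * (N + 1) = K * (N + 1) + (N + 1) := by ring
      omega
    · rw [Nat.add_right_comm k, ← List.append_assoc, ← encodeMonomials_append] at h₂
      have e : ((g.encode ++ gs.flatMap BoolGate.encode).head?).isSome = true := by
        cases g <;> simp [BoolGate.encode]
      exact .whileInp_step e h₁ h₂

/-- The counter `.fst` is zero during this loop, so `(.fst, 0)` in `symInput` denotes the variable
`0`, the switch. -/
theorem Exec.inputsProg : ∃ K, ∀ (n k : ℕ) (r inp out) (N : ℕ),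
    inp.head? ≠ some CircuitSymbol.tick → k + n ≤ N →
    ∃ t ≤ K * (N + 1) * n + 1, Exec inputsProg
      ⟨r, List.replicate n .tick ++ inp, out, ctrs k 0 0⟩
      ⟨r, inp, encodeMonomials (BoolCircuit.inputsMonomials k n) ++ out, ctrs (k + n) 0 0⟩ t := by
  obtain ⟨K, hK⟩ := Exec.printMonomials (ms := symInput) (by decide)
  refine ⟨K + 3, fun n => ?_⟩
  induction n with
  | zero => exact fun k r inp out N h _ => ⟨1, by omega, .whileInp_done (by simpa using h)⟩
  | succ n ih =>
    intro k r inp out N h hk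
    obtain ⟨t₁, ht₁, h₁⟩ := hK out r (List.replicate n .tick ++ inp) (ctrs k 0 0) N rfl
      (by intro c; cases c <;> (simp [ctrs]; try omega))
    obtain ⟨t₂, ht₂, h₂⟩ := ih (k + 1) r inp
      (encodeMonomials (BoolCircuit.inputMonomials k) ++ out) N h (by omega)
    have h₃ := Exec.inc .block (⟨r, List.replicate n .tick ++ inp, encodeMonomials
      (BoolCircuit.inputMonomials k) ++ out, ctrs k 0 0⟩ : PState CircuitSymbol _ _ _)
    rw [update_ctrs_block] at h₃
    refine ⟨1 + (t₁ + 1) + t₂ + 1, ?_, ?_⟩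
    · have : (K + 3) * (N + 1) = K * (N + 1) + 3 * (N + 1) := by ring
      rw [Nat.mul_succ]
      omega
    · rw [Nat.add_right_comm k, ← List.append_assoc, ← encodeMonomials_append] at h₂
      exact .whileInp_step rfl (.seq (.read _ _) (.seq h₁ h₃)) h₂

theorem encode_toCubic (C : BoolCircuit) : C.toCubic.encode =
    List.replicate C.polyVars .tick ++ encodeMonomials C.natMonomials := by
  refine congrArg (List.replicate C.polyVars PolySymbol.tick ++ ·) ?_
  refine (List.flatMap_map (fun m : List ℕ => m.map (Fin.ofNat C.polyVars)) _ _).trans ?_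
  refine List.flatMap_congr fun m hm => congrArg (PolySymbol.plus :: ·) ?_
  refine Eq.trans ?_ (congrArg encodeVars (C.map_val_ofNat hm))
  -- In `F2Poly.encode` the coercion of the variables to natural numbers is a monadic bind over the
  -- list; it equals the map of `Fin.val`.
  exact congrArg encodeVars (bind_pure_comp Fin.val (m.map (Fin.ofNat C.polyVars)))

theorem length_encode_ge (C : BoolCircuit) :
    C.numInputs + 1 + C.out + C.gates.length ≤ C.encode.length := by
  have h : ∀ gs : List BoolGate, gs.length ≤ (gs.flatMap BoolGate.encode).length := by
    intro gs
    induction gs with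
    | nil => simp
    | cons g gs ih =>
      rw [List.flatMap_cons, List.length_append, List.length_cons]
      have : 1 ≤ g.encode.length := by cases g <;> simp [BoolGate.encode]
      omega
  have := h C.gates
  simp only [BoolCircuit.encode, List.length_append, List.length_cons, List.length_replicate]
  omega

theorem inputs_le_length_encode (C : BoolCircuit) :
    ∀ g ∈ C.gates, ∀ i ∈ g.inputs, i ≤ C.encode.length := by
  intro g hg i hi
  obtain ⟨k, hk, rfl⟩ := List.mem_iff_getElem.1 hg
  have := C.gates_wf k hk i hi
  have := length_encode_ge C
  omega

/-- The polynomial is written back to front, which is why `natMonomials` lists the gates before the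
inputs and later blocks before earlier ones. The number of variables is written last: by then
`.block` has counted all blocks. The time is quadratic, at most linearly many monomials of linear
length. -/
theorem Exec.circuitProg : ∃ K, ∀ C : BoolCircuit, ∃ t ≤ K * (C.encode.length + 1) ^ 2,
    Exec circuitProg ⟨none, C.encode, [], fun _ => 0⟩ ⟨none, [], C.toCubic.encode, fun _ => 0⟩
      t := by
  obtain ⟨Kb, hb⟩ := Exec.printMonomials (ms := symBase) (by decide)
  obtain ⟨Ko, ho⟩ := Exec.printMonomials (ms := symOut) (by decide)
  obtain ⟨Ki, hi⟩ := Exec.inputsProg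
  obtain ⟨Kg, hg⟩ := Exec.gatesProg
  refine ⟨Kb + Ko + Ki + Kg + 40, fun C => ?_⟩
  have hlen := length_encode_ge C
  set N := C.encode.length with hN
  have e₀ : (fun _ => 0) = ctrs 0 0 0 := by funext c; cases c <;> rfl
  rw [e₀]
  have hle {k i : ℕ} (hk : k ≤ N) (hi : i ≤ N) : ∀ c, ctrs k i 0 c ≤ N := by
    intro c; cases c <;> simp [ctrs, hk, hi]
  let gates := C.gates.flatMap BoolGate.encode
  let out₁ := encodeMonomials BoolCircuit.baseMonomials
  let out₂ := encodeMonomials (BoolCircuit.inputsMonomials 1 C.numInputs) ++ out₁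
  let out₃ := encodeMonomials [[0, 2, 4 * C.out + 5]] ++ out₂
  let out₄ := encodeMonomials (BoolCircuit.gatesMonomials (1 + C.numInputs) C.gates) ++ out₃
  obtain ⟨t₁, ht₁, h₁⟩ := hb [] none C.encode (ctrs 0 0 0) N rfl
    (hle (Nat.zero_le _) (Nat.zero_le _))
  have h₁' : Exec (Prog.printMonomials symBase) ⟨none, C.encode, [], ctrs 0 0 0⟩
      ⟨none, C.encode, out₁, ctrs 0 0 0⟩ t₁ := by
    rw [List.append_nil] at h₁
    exact h₁
  have h₂ := Exec.inc .block (⟨none, C.encode, out₁, ctrs 0 0 0⟩ :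
    PState _ _ _ (Option CircuitSymbol))
  rw [update_ctrs_block] at h₂
  obtain ⟨t₃, ht₃, h₃⟩ := hi C.numInputs 1 none
    (.comma :: (List.replicate C.out .tick ++ gates)) out₁ N (by simp) (by omega)
  have h₅ := Exec.countSym CircuitSymbol.tick .fst C.out (inp := gates)
    (head?_encode_gates C.gates) (none : Option CircuitSymbol) out₂ (ctrs (1 + C.numInputs) 0 0)
  rw [update_ctrs_fst] at h₅
  obtain ⟨t₆, ht₆, h₆⟩ := ho out₂ none gates (ctrs (1 + C.numInputs) (0 + C.out) 0) N rfl
    (hle (by omega) (by omega))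
  have h₆' : Exec (Prog.printMonomials symOut)
      ⟨none, gates, out₂, ctrs (1 + C.numInputs) (0 + C.out) 0⟩
      ⟨none, gates, out₃, ctrs (1 + C.numInputs) (0 + C.out) 0⟩ t₆ := by
    -- Here `.snd` is zero and `.fst` holds the output wire, so the three symbols denote `s`, `y`
    -- and the output value.
    have e : symOut.map (fun m => m.map
        (SymVar.value (ctrs (1 + C.numInputs) (0 + C.out) 0))) = [[0, 2, 4 * C.out + 5]] := by
      simp [symOut, SymVar.value, ctrs]
    rw [e] at h₆
    exact h₆
  have h₇ := Exec.clear .fst (none : Option CircuitSymbol) gates out₃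
    (ctrs (1 + C.numInputs) (0 + C.out) 0)
  rw [update_ctrs_fst] at h₇
  obtain ⟨r, t₈, ht₈, h₈⟩ := hg C.gates (1 + C.numInputs) none out₃ N (by omega)
    (inputs_le_length_encode C)
  have h₉ := Exec.whileCtr_write .block PolySymbol.tick 4 r ([] : List CircuitSymbol) out₄
    (ctrs (1 + C.numInputs + C.gates.length) 0 0)
  rw [update_ctrs_block] at h₉
  have e : C.toCubic.encode = List.replicate
      (4 * ctrs (1 + C.numInputs + C.gates.length) 0 0 .block) .tick ++ out₄ := by
    rw [encode_toCubic, BoolCircuit.natMonomials, encodeMonomials_append, encodeMonomials_append,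
      encodeMonomials_append, BoolCircuit.polyVars, Nat.add_comm C.numInputs 1,
      show C.numInputs + C.gates.length + 1 = 1 + C.numInputs + C.gates.length by omega]
    rfl
  rw [e]
  refine ⟨_, ?_, .seq h₁' (.seq h₂ (.seq h₃ (.seq (.read _ _) (.seq h₅ (.seq h₆' (.seq h₇
    (.seq h₈ (.seq h₉ (.load _ _)))))))))⟩
  have b₁ : Ki * (N + 1) * C.numInputs ≤ Ki * (N + 1) * (N + 1) :=
    Nat.mul_le_mul_left _ (by omega)
  have b₂ : Kg * (N + 1) * C.gates.length ≤ Kg * (N + 1) * (N + 1) :=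
    Nat.mul_le_mul_left _ (by omega)
  have b₃ : Kb * (N + 1) * 1 ≤ Kb * (N + 1) * (N + 1) := Nat.mul_le_mul_left _ (by omega)
  have b₄ : Ko * (N + 1) * 1 ≤ Ko * (N + 1) * (N + 1) := Nat.mul_le_mul_left _ (by omega)
  have b₅ : 1 * (N + 1) ≤ (N + 1) * (N + 1) := Nat.mul_le_mul_right _ (by omega)
  have b₆ : (Kb + Ko + Ki + Kg + 40) * (N + 1) ^ 2 = Kb * (N + 1) * (N + 1) +
    Ko * (N + 1) * (N + 1) + Ki * (N + 1) * (N + 1) + Kg * (N + 1) * (N + 1) +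
    40 * ((N + 1) * (N + 1)) := by ring
  rw [b₆]
  simp only [ctrs]
  omega

/-- The polynomial of a circuit is computable in polynomial time. -/
theorem polyTimeComputable_toCubic :
    PolyTimeComputable BoolCircuit.encode CubicF2Poly.encode BoolCircuit.toCubic := by
  obtain ⟨K, hK⟩ := Exec.circuitProg
  refine tm2ComputableInPolyTime Prog.circuitProg none
    (Polynomial.C K * (Polynomial.X + 1) ^ 2 + 1) fun C => ?_
  obtain ⟨t, ht, h⟩ := hK C
  refine ⟨t, h, ?_⟩
  simp only [Polynomial.eval_add, Polynomial.eval_mul, Polynomial.eval_C, Polynomial.eval_pow,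
    Polynomial.eval_X, Polynomial.eval_one]
  omega

end Turing.Prog

/-! ### Recovering the count from the gap -/

/-- Remove the low zeros of a binary number, and its lowest one. -/
def PosNum.dropLowBits : PosNum → Num
  | .one => 0
  | .bit0 p => p.dropLowBits
  | .bit1 p => .pos p

theorem PosNum.dropLowBits_eq {a F : ℕ} {p : PosNum} (h : (p : ℕ) = 2 ^ a * (2 * F + 1)) :
    (p.dropLowBits : ℕ) = F := by
  induction p generalizing a with
  | one =>
    have := Nat.eq_one_of_mul_eq_one_left (h.symm.trans PosNum.cast_one)
    change 0 = F
    omega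
  | bit0 p ih =>
    cases a with
    | zero => simp only [PosNum.cast_bit0] at h; omega
    | succ a =>
      refine ih (a := a) ?_
      rw [PosNum.cast_bit0, pow_succ, mul_right_comm] at h
      omega
  | bit1 p ih =>
    cases a with
    | zero =>
      rw [PosNum.cast_bit1, pow_zero, one_mul] at h
      simp [dropLowBits]
      omega
    | succ a =>
      rw [PosNum.cast_bit1, pow_succ, mul_right_comm] at h
      omega

/-- Binary numbers are written with the lowest bit first, so `dropLowBits` deletes a prefix of the
word. -/
theorem encodePosNum_eq (p : PosNum) : ∃ a, Computability.encodePosNum p =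
    List.replicate a false ++ true :: Computability.encodeNum p.dropLowBits := by
  induction p with
  | one => exact ⟨0, rfl⟩
  | bit0 p ih =>
    obtain ⟨a, h⟩ := ih
    refine ⟨a + 1, ?_⟩
    rw [Computability.encodePosNum, h]
    rfl
  | bit1 p => exact ⟨0, rfl⟩

/-- The number `F`, given an integer of the form `2 ^ a * (2 * F + 1)`. -/
def oddIndex (z : ℤ) : ℕ :=
  match (z.natAbs : Num) with
  | .zero => 0
  | .pos p => p.dropLowBits

theorem oddIndex_eq {z : ℤ} {a F : ℕ} (h : z = 2 ^ a * (2 * F + 1)) : oddIndex z = F := by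
  have h' : z.natAbs = 2 ^ a * (2 * F + 1) := by
    zify
    rw [abs_of_nonneg (by rw [h]; positivity), h]
  have hn : (((z.natAbs : ℕ) : Num) : ℕ) = 2 ^ a * (2 * F + 1) := by rw [Num.to_of_nat, h']
  rw [oddIndex]
  cases hz : ((z.natAbs : ℕ) : Num) with
  | zero =>
    rw [hz] at hn
    have : 0 < 2 ^ a * (2 * F + 1) := by positivity
    have h0 : ((Num.zero : Num) : ℕ) = 0 := rfl
    omega
  | pos p =>
    rw [hz] at hn
    exact PosNum.dropLowBits_eq hn

theorem encodeInt_eq (z : ℤ) : ∃ s a, encodeInt z = s :: List.replicate a false ∧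
      Computability.encodeNat (oddIndex z) = [] ∨
    encodeInt z = s :: (List.replicate a false ++ true ::
      Computability.encodeNat (oddIndex z)) := by
  refine ⟨decide (z < 0), ?_⟩
  rw [encodeInt, oddIndex, Computability.encodeNat]
  cases ((z.natAbs : ℕ) : Num) with
  | zero => exact ⟨0, .inl ⟨rfl, rfl⟩⟩
  | pos p =>
    obtain ⟨a, h⟩ := encodePosNum_eq p
    refine ⟨a, .inr ?_⟩
    rw [Computability.encodeNum, h, Computability.encodeNat, Num.of_to_nat]

/-! ### Programs that decode the gap -/

namespace Turing.Prog

/-- Move the input to the output, in reverse order. -/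
def moveProg {A : Type} [Inhabited A] (f : A → Bool) : Prog A Bool Empty (Option A) :=
  .whileInp Option.isSome (.seq (.read fun _ o => o) (.write fun r => f (r.getD default)))

theorem Exec.moveProg {A : Type} [Inhabited A] (f : A → Bool) (inp : List A) (out : List Bool)
    (r : Option A) (ctr : Empty → ℕ) : ∃ r', Exec (moveProg f) ⟨r, inp, out, ctr⟩
      ⟨r', [], (inp.map f).reverse ++ out, ctr⟩ (3 * inp.length + 1) := by
  induction inp generalizing r out with
  | nil => exact ⟨r, .whileInp_done rfl⟩
  | cons a inp ih =>
    obtain ⟨r', h⟩ := ih (f a :: out) (some a)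
    refine ⟨r', ?_⟩
    rw [List.map_cons, List.reverse_cons, List.append_assoc]
    exact Exec.cast (.whileInp_step rfl (.seq (.read _ _) (.write _ _)) h) (by simp; ring)

/-- The program that recovers the digits of the count, in reverse order. -/
def oddIndexProg : Prog (Bool ⊕ Bool) Bool Empty (Option (Bool ⊕ Bool)) :=
  .seq (skipWhile Sum.isLeft) <| .seq (.read fun r _ => r) <|
  .seq (skipWhile fun x => x == .inr false) <| .seq (.read fun r _ => r) <|
  .seq (moveProg (Sum.elim id id)) (.load fun _ => none)

/-- The digits wanted are a suffix of the input, but copying from stack to stack reverses them; a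
second machine, composed with this one, reverses them back. -/
theorem polyTimeComputable_oddIndex_reverse :
    PolyTimeComputable (encodePair (id : List Bool → List Bool) encodeInt)
      (fun n => (Computability.encodeNat n).reverse) (fun p => oddIndex p.2) := by
  refine tm2ComputableInPolyTime oddIndexProg none (Polynomial.C 3 * Polynomial.X + 20) ?_
  rintro ⟨w, z⟩
  obtain ⟨s, a, h⟩ := encodeInt_eq z
  -- The case `z = 0` never occurs for a gap, but the machine must be correct on every input.
  -- Reading from an empty stack does nothing, so both cases follow the same run and the result is
  -- `rest.tail`.
  obtain ⟨rest, h₁, h₂⟩ : ∃ rest, encodeInt z = s :: (List.replicate a false ++ rest) ∧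
      (rest = [] ∧ Computability.encodeNat (oddIndex z) = [] ∨
        rest = true :: Computability.encodeNat (oddIndex z)) := by
    rcases h with ⟨h, h'⟩ | h
    · exact ⟨[], by simpa using h, .inl ⟨rfl, h'⟩⟩
    · exact ⟨_, h, .inr rfl⟩
  have e₁ : encodePair id encodeInt (w, z) = w.map .inl ++ (.inr s ::
      ((List.replicate a false).map .inr ++ rest.map .inr)) := by
    simp [encodePair, h₁]
  have e₂ : rest.tail = Computability.encodeNat (oddIndex z) := by
    rcases h₂ with ⟨h, h'⟩ | h
    · rw [h, h']; rfl
    · rw [h]; rfl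
  have e₃ : (rest.map (.inr : Bool → Bool ⊕ Bool)).head?.any (fun x => x == .inr false) =
      false := by
    rcases h₂ with ⟨h, h'⟩ | h <;> rw [h] <;> rfl
  have r₁ := Exec.skipWhile (Sum.isLeft (α := Bool) (β := Bool)) (x := w.map .inl) (by simp)
    (inp := .inr s :: ((List.replicate a false).map .inr ++ rest.map .inr)) rfl
    (none : Option (Bool ⊕ Bool)) ([] : List Bool) (fun _ : Empty => 0)
  have r₂ := Exec.skipWhile (fun x : Bool ⊕ Bool => x == .inr false)
    (x := (List.replicate a false).map .inr) (by simp; intro; rfl) e₃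
    (none : Option (Bool ⊕ Bool)) ([] : List Bool) (fun _ : Empty => 0)
  obtain ⟨r', r₃⟩ := Exec.moveProg (Sum.elim id id) (rest.map (.inr : Bool → Bool ⊕ Bool)).tail []
    none fun _ => 0
  rw [← List.map_tail, List.map_map, e₂, List.append_nil,
    show Sum.elim id id ∘ (Sum.inr : Bool → Bool ⊕ Bool) = id from rfl, List.map_id,
    List.length_map, show (Computability.encodeNat (oddIndex z)).map (.inr : Bool → Bool ⊕ Bool) =
      (rest.map .inr).tail by rw [← List.map_tail, e₂]] at r₃
  have hlen : (Computability.encodeNat (oddIndex z)).length ≤ rest.length := by simp [← e₂]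
  rw [e₁]
  refine ⟨_, .seq r₁ (.seq (.read _ _) (.seq r₂ (.seq (.read _ _) (.seq r₃ (.load _ _))))), ?_⟩
  simp
  omega

theorem polyTimeComputable_reverse :
    PolyTimeComputable (fun n => (Computability.encodeNat n).reverse) Computability.encodeNat
      id := by
  refine tm2ComputableInPolyTime (.seq (moveProg (id : Bool → Bool)) (.load fun _ => none)) none
    (Polynomial.C 3 * Polynomial.X + 20) fun n => ?_
  obtain ⟨r', h⟩ := Exec.moveProg id (Computability.encodeNat n).reverse [] none fun _ => 0
  rw [List.map_id, List.append_nil, List.reverse_reverse] at h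
  refine ⟨_, .seq h (.load _ _), ?_⟩
  simp
  omega

theorem polyTimeComputable_oddIndex :
    PolyTimeComputable (encodePair (id : List Bool → List Bool) encodeInt)
      Computability.encodeNat (fun p => oddIndex p.2) := by
  obtain ⟨h₁⟩ := polyTimeComputable_oddIndex_reverse
  obtain ⟨h₂⟩ := polyTimeComputable_reverse
  exact h₁.comp h₂

end Turing.Prog

/-! ### The hardness theorem -/

instance : Inhabited CircuitSymbol := ⟨.tick⟩

theorem proposition2 :
    SharpPHard CubicF2Poly.encode encodeInt CubicF2Poly.gap := by
  rintro F ⟨C, ⟨hC⟩, hF⟩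
  refine ⟨fun w => (C w).toCubic, fun p => oddIndex p.2, ?_,
    Turing.Prog.polyTimeComputable_oddIndex, fun w => ?_⟩
  · obtain ⟨h⟩ := Turing.Prog.polyTimeComputable_toCubic
    exact hC.comp h
  · rw [hF]
    -- The power of `4` in the gap, as a power of `2`.
    refine (oddIndex_eq (a := 2 * ((C w).numInputs + (C w).gates.length + 1)) ?_).symm
    rw [(C w).gap_toCubic, pow_mul]
    norm_num
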